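/- Let $\mathbb K$ be a field and let $E=(E^0,E^1,r,s)$ be a directed graph with $E^0$ finite and $E^1$ arbitrary, where $r,s:E^1\to E^0$ are the range and source maps. Let ${\rm Reg}(E)$ be the set of vertices $v$ for which $s^{-1}(v)$ is finite and nonempty, and let $V\subseteq {\rm Reg}(E)$. The relative Leavitt path algebra $L=L^V_{\mathbb K}(E)$ is the unital associative $\mathbb K$-algebra generated by the vertices $v\in E^0$, the edges $e\in E^1$ and the ghost edges $e^*$ $(e\in E^1)$ subject to the relations (where $\delta$ is the Kronecker delta): $vw=\delta(v,w)v$ for $v,w\in E^0$; $s(e)e=e=er(e)$ and $r(e)e^*=e^*=e^*s(e)$ for $e\in E^1$; $\sum_{v\in E^0}v=1$; $e^*f=\delta(e,f)r(e)$ for $e,f\in E^1$; and $\sum_{e\in s^{-1}(v)}ee^*=v$ for $v\in V$. For vertices $v,w$ write $v\ge w$ if there is a path (possibly of length $0$) from $v$ to $w$. A cycle is a closed path $(e_1,\dots,e_n)$, $n\ge 1$, with $s(e_1),\dots,s(e_n)$ pairwise distinct. For cycles $\omega,\xi$ write $\omega\ge\xi$ if there is a path from a vertex of $\omega$ to a vertex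 of $\xi$. A cycle $\omega$ is maximal if, for every cycle $\xi$, $\xi\ge\omega$ implies $\omega\ge\xi$; it is exclusive if every cycle that shares a vertex with $\omega$ is a cyclic rotation of $\omega$. A set $Y\subseteq E^0$ is hereditary if $x\in Y$ and $x\ge v$ imply $v\in Y$, and $V$-saturated if, for every $v\in V$, $r(s^{-1}(v))\subseteq Y$ implies $v\in Y$. Let $X$ be the smallest hereditary and $V$-saturated subset of $E^0$ that contains all the vertices of all the cycles of $E$. Then the following statements are equivalent (all modules are right modules). 1. $L$ is amenable: for every finite dimensional subspace $U\subseteq L$ and every real number $p>1$ there is a finite dimensional subspace $W\subseteq L$ with $\dim_{\mathbb K}(UW)<p\,\dim_{\mathbb K}W$, where $UW$ is the span of all products $uw$ with $u\in U$, $w\in W$. 2. $L$ satisfies the strong rank condition: there is no positive integer $n$ with an $L$-module monomorphism $L^{n+1}\to L^n$. 3. There is no $L$-module monomorphism $L^2\to L$. 4. $L$ satisfies the rank condition: there is no positive integer $n$ with an $L$-module epimorphism $L^n\to L^{n+1}$. 5. ${\rm gn}(L)>1$, where ${\rm gn}(L)$ is the smallest positive integer $n$ such that there is an $L$-module epimorphism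 $L^n\to L^{n+1}$, and ${\rm gn}(L)=\infty$ if there is no such $n$. 6. $X\ne E^0$, or $E$ contains a cycle that is both exclusive and maximal. -/

import Mathlib

/-- A directed graph with vertex set `E₀` and edge set `E₁` (loops and parallel edges allowed):
every edge has a source and a range. -/
structure DirGraph (E₀ : Type*) (E₁ : Type*) where
  /-- the source function -/
  s : E₁ → E₀
  /-- the range function -/
  r : E₁ → E₀

namespace DirGraph

variable {E₀ : Type*} {E₁ : Type*} (E : DirGraph E₀ E₁)

/-- `E.IsPath v α w`: the list of edges `α` is a path with source `v` and range `w`.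
The empty list represents the path of length `0` at each vertex. -/
inductive IsPath : E₀ → List E₁ → E₀ → Prop
  | nil (v : E₀) : IsPath v [] v
  | cons (e : E₁) {α : List E₁} {w : E₀} (h : IsPath (E.r e) α w) : IsPath (E.s e) (e :: α) w

/-- The quasiordering `v ≥ w` on vertices: there is a path (possibly of length `0`)
from `v` to `w`. -/
def Reaches (v w : E₀) : Prop := ∃ α : List E₁, E.IsPath v α w

/-- The set of vertices on a path of positive length. -/
def Vert (α : List E₁) : Set E₀ := {v | ∃ e ∈ α, E.s e = v ∨ E.r e = v}

/-- A cycle: a closed path of positive length whose edges have pairwise distinct sources. -/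
structure IsCycle (ω : List E₁) : Prop where
  ne_nil : ω ≠ []
  closed : ∃ v : E₀, E.IsPath v ω v
  nodup : (ω.map E.s).Nodup

/-- The quasiordering on cycles induced by the one on vertices: there is a path from a vertex
of `ω` to a vertex of `ξ`. -/
def CycleReaches (ω ξ : List E₁) : Prop := ∃ v ∈ E.Vert ω, ∃ w ∈ E.Vert ξ, E.Reaches v w

/-- A cycle is maximal if it is a maximal element, among all cycles, of the quasiordering. -/
def IsMaximalCycle (ω : List E₁) : Prop :=
  E.IsCycle ω ∧ ∀ ξ : List E₁, E.IsCycle ξ → E.CycleReaches ξ ω → E.CycleReaches ω ξ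

/-- A cycle is exclusive if it shares no vertex with any other cycle. As usual, changing the
basepoint of a cycle (a cyclic rotation of its edges) does not give another cycle. -/
def IsExclusiveCycle (ω : List E₁) : Prop :=
  E.IsCycle ω ∧ ∀ ξ : List E₁, E.IsCycle ξ → (E.Vert ω ∩ E.Vert ξ).Nonempty → ω.IsRotated ξ

/-- The set `Reg(E)` of regular vertices: those that emit at least one and only finitely
many edges. -/
def Reg : Set E₀ := {v | {e : E₁ | E.s e = v}.Nonempty ∧ {e : E₁ | E.s e = v}.Finite}

/-- A set of vertices is hereditary if it is closed under going down in the quasiordering. -/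
def IsHereditary (X : Set E₀) : Prop := ∀ x ∈ X, ∀ v : E₀, E.Reaches x v → v ∈ X

/-- `X` is `V`-saturated if `r(s⁻¹(v)) ⊆ X` implies `v ∈ X` for all `v ∈ V`. -/
def IsSaturated (V X : Set E₀) : Prop := ∀ v ∈ V, E.r '' {e : E₁ | E.s e = v} ⊆ X → v ∈ X

/-- The hereditary and `V`-saturated sets containing all the vertices of all cycles. -/
def HerSatSets (V : Set E₀) : Set (Set E₀) :=
  {Y | E.IsHereditary Y ∧ E.IsSaturated V Y ∧ ∀ ω : List E₁, E.IsCycle ω → E.Vert ω ⊆ Y}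

/-- The smallest hereditary and `V`-saturated set of vertices that contains all the vertices of
all the cycles. -/
def cycleClosure (V : Set E₀) : Set E₀ := ⋂₀ E.HerSatSets V

/-- The intersection defining `cycleClosure` is indeed the smallest such set. -/
theorem isLeast_cycleClosure (V : Set E₀) : IsLeast (E.HerSatSets V) (E.cycleClosure V) := by
  refine ⟨⟨?_, ?_, ?_⟩, fun Y hY => Set.sInter_subset_of_mem hY⟩
  · intro x hx v hv Y hY
    exact hY.1 x (hx Y hY) v hv
  · intro v hv h Y hY
    exact hY.2.1 v hv (h.trans (Set.sInter_subset_of_mem hY))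
  · intro ω hω v hv Y hY
    exact hY.2.2 ω hω hv

/-- Generators of the relative Leavitt path algebra: vertices, edges and ghost edges. -/
inductive Gen (E₀ : Type*) (E₁ : Type*)
  | vertex (v : E₀) : Gen E₀ E₁
  | edge (e : E₁) : Gen E₀ E₁
  | ghost (e : E₁) : Gen E₀ E₁

section Leavitt

variable (K : Type*) [CommRing K]

/-- A vertex as an element of the free algebra. -/
def gv (v : E₀) : FreeAlgebra K (Gen E₀ E₁) := FreeAlgebra.ι K (Gen.vertex v)

/-- An edge as an element of the free algebra. -/
def ge (e : E₁) : FreeAlgebra K (Gen E₀ E₁) := FreeAlgebra.ι K (Gen.edge e)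

/-- The ghost edge `e*` as an element of the free algebra. -/
def gs (e : E₁) : FreeAlgebra K (Gen E₀ E₁) := FreeAlgebra.ι K (Gen.ghost e)

/-- The defining relations of the relative Leavitt path algebra of `E` with respect to `V`.
In `sum_out` the finite set `S` is the set `s⁻¹(v)` of all edges emitted by `v`. -/
inductive LeavittRel [Fintype E₀] (V : Set E₀) :
    FreeAlgebra K (Gen E₀ E₁) → FreeAlgebra K (Gen E₀ E₁) → Prop
  | vertex_idem (v : E₀) : LeavittRel V (gv K v * gv K v) (gv K v)
  | vertex_orth (v w : E₀) (h : v ≠ w) : LeavittRel V (gv K v * gv K w) 0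
  | src_edge (e : E₁) : LeavittRel V (gv K (E.s e) * ge K e) (ge K e)
  | edge_rng (e : E₁) : LeavittRel V (ge K e * gv K (E.r e)) (ge K e)
  | sum_vertex : LeavittRel V (∑ v : E₀, gv K v) 1
  | rng_ghost (e : E₁) : LeavittRel V (gv K (E.r e) * gs K e) (gs K e)
  | ghost_src (e : E₁) : LeavittRel V (gs K e * gv K (E.s e)) (gs K e)
  | ghost_edge (e : E₁) : LeavittRel V (gs K e * ge K e) (gv K (E.r e))
  | ghost_edge_ne (e f : E₁) (h : e ≠ f) : LeavittRel V (gs K e * ge K f) 0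
  | sum_out (v : E₀) (hv : v ∈ V) (S : Finset E₁) (hS : ∀ e : E₁, e ∈ S ↔ E.s e = v) :
      LeavittRel V (∑ e ∈ S, ge K e * gs K e) (gv K v)

/-- The relative Leavitt path algebra `L^V_K(E)`: the unital associative `K`-algebra presented by
the generators `Gen` and the relations `LeavittRel`. -/
abbrev RelLeavitt [Fintype E₀] (V : Set E₀) : Type _ := RingQuot (E.LeavittRel K V)

end Leavitt

end DirGraph

section RankConditions

variable (R : Type*) [Ring R]

/-- The rank condition: for no positive integer `n` is there an epimorphism `Rⁿ → Rⁿ⁺¹` of right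
`R`-modules (right `R`-modules are modules over `Rᵐᵒᵖ`). -/
def RightRankCondition : Prop :=
  ∀ n : ℕ, 0 < n →
    ¬ ∃ f : (Fin n → R) →ₗ[Rᵐᵒᵖ] (Fin (n + 1) → R), Function.Surjective f

/-- The strong rank condition: for no positive integer `n` is there a monomorphism `Rⁿ⁺¹ → Rⁿ` of
right `R`-modules. -/
def RightStrongRankCondition : Prop :=
  ∀ n : ℕ, 0 < n →
    ¬ ∃ f : (Fin (n + 1) → R) →ₗ[Rᵐᵒᵖ] (Fin n → R), Function.Injective f

/-- The generating number: the smallest positive integer `n` with an epimorphism `Rⁿ → Rⁿ⁺¹` of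
right `R`-modules, and `⊤` (infinite) if there is none, that is, if `R` satisfies the rank
condition. -/
noncomputable def generatingNumber : ℕ∞ :=
  sInf {m : ℕ∞ | ∃ n : ℕ, m = n ∧ 0 < n ∧
    ∃ f : (Fin n → R) →ₗ[Rᵐᵒᵖ] (Fin (n + 1) → R), Function.Surjective f}

end RankConditions

/-- Amenability of a `K`-algebra `A`: for every finite dimensional subspace `U` and every real
`p > 1` there is a finite dimensional subspace `W` with `dim (U W) < p dim W`. Here `U * W` is the
linear span of all products `u w`. -/
def AmenableAlgebra (K : Type*) [Field K] (A : Type*) [Ring A] [Algebra K A] : Prop :=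
  ∀ U : Submodule K A, FiniteDimensional K U → ∀ p : ℝ, 1 < p →
    ∃ W : Submodule K A, FiniteDimensional K W ∧
      (Module.finrank K (U * W : Submodule K A) : ℝ) < p * (Module.finrank K W : ℝ)

/-! ### Paths, cycles and branching in the graph. -/

namespace DirGraph

variable {E₀ : Type*} {E₁ : Type*} {E : DirGraph E₀ E₁}

/-! Amenability gives the strong rank condition by a dimension count. Since epimorphisms onto free
modules split, the strong rank condition gives the other rank conditions, and each of these excludes
an epimorphism `L → L²`. It remains to find such an epimorphism if 6 fails (`mapsOnto_prod_self`)
and Følner subspaces if 6 holds (`amenable_relLeavitt`).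

Suppose that 6 fails. Above every vertex on a cycle there is a vertex `v` with two different edges
from which one can return to `v` (`exists_branch`), so `vL` maps onto `(vL)²`. Let `τ` be the sum of
all `vL` that map onto their squares. Then `τ` maps onto `τⁿ` for all `n`, and the vertices `w` such
that `τ` maps onto `wL` form a hereditary and `V`-saturated set containing all cycles, hence all
vertices. Therefore `L ↠ τ ↠ τ² ↠ L²`.

Suppose that the closure of the cycles is not everything. Some `z ∉ V` is then reached by no cycle
(`exists_not_reached`), so for a finite set `F` of edges only finitely many paths in `F` end at `z`.
Let `q` be `z` minus the sum of `ee*` over the edges of `F` with source `z`. As `f*q = 0` for `f ∈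
F`, the products `γq` span a finite dimensional space stable under all generators from `F`.

Suppose that `z` lies on an exclusive maximal cycle. A path to `z` has entered the cycle after `|E₀|
+ 1` edges and is forced from there on, so the number of paths in `F` of a given length is bounded
(`exists_ncard_pathsTo_le`). Paths with lengths in a long interval span a space of large dimension
with boundary of bounded dimension.

That `q ≠ 0`, and that paths of different lengths are independent, is seen in a representation with
basis `E₀ × B × ℤ`, built from `exists_branching`. -/

theorem isPath_nil_iff {u w : E₀} : E.IsPath u [] w ↔ u = w := by
  constructor
  · intro h; cases h; rfl
  · rintro rfl; exact .nil _

theorem isPath_cons_iff {u w : E₀} {e : E₁} {α : List E₁} :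
    E.IsPath u (e :: α) w ↔ E.s e = u ∧ E.IsPath (E.r e) α w := by
  constructor
  · intro h; cases h with | cons _ h => exact ⟨rfl, h⟩
  · rintro ⟨rfl, h⟩; exact .cons e h

theorem isPath_append_iff {u w : E₀} {α β : List E₁} :
    E.IsPath u (α ++ β) w ↔ ∃ v, E.IsPath u α v ∧ E.IsPath v β w := by
  induction α generalizing u with
  | nil => simp [isPath_nil_iff]
  | cons e α ih => simp [isPath_cons_iff, ih, and_assoc]

theorem Reaches.refl (v : E₀) : E.Reaches v v := ⟨[], .nil v⟩

theorem Reaches.trans {u v w : E₀} : E.Reaches u v → E.Reaches v w → E.Reaches u w := by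
  rintro ⟨α, hα⟩ ⟨β, hβ⟩
  exact ⟨α ++ β, isPath_append_iff.2 ⟨v, hα, hβ⟩⟩

theorem Reaches.edge (e : E₁) : E.Reaches (E.s e) (E.r e) := ⟨[e], .cons e (.nil _)⟩

/-- The endpoints of a nonempty path are determined by its edges. -/
theorem IsPath.range_unique {u v w w' : E₀} {α : List E₁} (hα : α ≠ [])
    (h : E.IsPath u α w) (h' : E.IsPath v α w') : w = w' := by
  induction α generalizing u v with
  | nil => exact absurd rfl hα
  | cons e α ih =>
    rw [isPath_cons_iff] at h h'
    rcases eq_or_ne α [] with rfl | hne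
    · rw [isPath_nil_iff] at h h'
      exact h.2.symm.trans h'.2
    · exact ih hne h.2 h'.2

theorem IsPath.exists_split {u w : E₀} {α : List E₁} (h : E.IsPath u α w) {x : E₀}
    (hx : x ∈ α.map E.s) :
    ∃ α₁ e α₂, α = α₁ ++ e :: α₂ ∧ E.s e = x ∧ E.IsPath u α₁ x ∧ E.IsPath x (e :: α₂) w := by
  obtain ⟨e, he, rfl⟩ := List.mem_map.1 hx
  obtain ⟨α₁, α₂, rfl⟩ := List.append_of_mem he
  obtain ⟨v, h₁, h₂⟩ := isPath_append_iff.1 h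
  obtain ⟨rfl, h₃⟩ := isPath_cons_iff.1 h₂
  exact ⟨α₁, e, α₂, rfl, rfl, h₁, h₂⟩

theorem IsPath.source_mem {u w : E₀} {α : List E₁} (h : E.IsPath u α w) (hα : α ≠ []) :
    u ∈ α.map E.s := by
  cases h with
  | nil => exact absurd rfl hα
  | cons e h => simp

theorem IsPath.range_mem {u w : E₀} {α : List E₁} (h : E.IsPath u α w) {e : E₁} (he : e ∈ α) :
    E.r e = w ∨ E.r e ∈ α.map E.s := by
  obtain ⟨α₁, α₂, rfl⟩ := List.append_of_mem he
  obtain ⟨v, -, h₂⟩ := isPath_append_iff.1 h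
  have h₃ := (isPath_cons_iff.1 h₂).2
  rcases eq_or_ne α₂ [] with rfl | hne
  · exact .inl (isPath_nil_iff.1 h₃)
  · right
    have := h₃.source_mem hne
    simp only [List.map_append, List.map_cons, List.mem_append, List.mem_cons]
    exact .inr (.inr this)

theorem IsCycle.mem_vert_iff {ω : List E₁} (hω : E.IsCycle ω) {x : E₀} :
    x ∈ E.Vert ω ↔ x ∈ ω.map E.s := by
  obtain ⟨v, hv⟩ := hω.closed
  constructor
  · rintro ⟨e, he, rfl | rfl⟩
    · exact List.mem_map_of_mem he
    · rcases hv.range_mem he with h | h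
      · rw [h]; exact hv.source_mem hω.ne_nil
      · exact h
  · intro hx
    obtain ⟨e, he, rfl⟩ := List.mem_map.1 hx
    exact ⟨e, he, .inl rfl⟩

theorem IsPath.reaches_of_mem {u w x : E₀} {α : List E₁} (h : E.IsPath u α w)
    (hx : x ∈ α.map E.s) : E.Reaches u x ∧ E.Reaches x w := by
  obtain ⟨α₁, e, α₂, -, -, h₁, h₂⟩ := h.exists_split hx
  exact ⟨⟨_, h₁⟩, ⟨_, h₂⟩⟩

theorem IsCycle.reaches {ω : List E₁} (hω : E.IsCycle ω) {x y : E₀}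
    (hx : x ∈ ω.map E.s) (hy : y ∈ ω.map E.s) : E.Reaches x y := by
  obtain ⟨v, hv⟩ := hω.closed
  exact (hv.reaches_of_mem hx).2.trans (hv.reaches_of_mem hy).1

theorem IsCycle.range_mem {ω : List E₁} (hω : E.IsCycle ω) {e : E₁} (he : e ∈ ω) :
    E.r e ∈ ω.map E.s :=
  hω.mem_vert_iff.1 ⟨e, he, .inr rfl⟩

theorem IsCycle.exists_edge_to {ω : List E₁} (hω : E.IsCycle ω) {x : E₀}
    (hx : x ∈ ω.map E.s) : ∃ e ∈ ω, E.r e = x := by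
  obtain ⟨v, hv⟩ := hω.closed
  have key : ∀ (α : List E₁) (u w : E₀), α ≠ [] → E.IsPath u α w → ∃ e ∈ α, E.r e = w := by
    intro α
    induction α with
    | nil => intro u w h; exact absurd rfl h
    | cons e α ih =>
      intro u w _ h
      rw [isPath_cons_iff] at h
      rcases eq_or_ne α [] with rfl | hne
      · exact ⟨e, by simp, isPath_nil_iff.1 h.2⟩
      · obtain ⟨f, hf, h'⟩ := ih _ _ hne h.2
        exact ⟨f, by simp [hf], h'⟩
  obtain ⟨α₁, e, α₂, rfl, hs, h₁, h₂⟩ := hv.exists_split hx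
  rcases eq_or_ne α₁ [] with rfl | hne
  · obtain ⟨f, hf, h'⟩ := key _ _ _ (by simp) hv
    exact ⟨f, hf, h'.trans (isPath_nil_iff.1 h₁)⟩
  · obtain ⟨f, hf, h'⟩ := key _ _ _ hne h₁
    exact ⟨f, by simp [hf], h'⟩

/-- A cycle can be rotated so that it starts at any prescribed vertex on it. -/
theorem IsCycle.exists_rotation {ω : List E₁} (hω : E.IsCycle ω) {x : E₀}
    (hx : x ∈ ω.map E.s) :
    ∃ e α, ω.IsRotated (e :: α) ∧ E.s e = x ∧ E.IsPath (E.r e) α x ∧ x ∉ α.map E.s := by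
  obtain ⟨v, hv⟩ := hω.closed
  obtain ⟨α₁, e, α₂, rfl, rfl, h₁, h₂⟩ := hv.exists_split hx
  have hrot : (α₁ ++ e :: α₂).IsRotated (e :: (α₂ ++ α₁)) := by
    simpa using List.isRotated_append (l := α₁) (l' := e :: α₂)
  refine ⟨e, α₂ ++ α₁, hrot, rfl, isPath_append_iff.2 ⟨v, (isPath_cons_iff.1 h₂).2, h₁⟩, ?_⟩
  have := (hrot.map E.s).nodup_iff.1 hω.nodup
  rw [List.map_cons, List.nodup_cons] at this
  exact this.1

/-- A path with a repeated source contains a cycle. -/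
theorem IsPath.exists_isCycle {u w : E₀} {γ : List E₁} (h : E.IsPath u γ w)
    (hγ : ¬ (γ.map E.s).Nodup) : ∃ α β δ, γ = α ++ β ++ δ ∧ E.IsCycle β := by
  induction γ generalizing u with
  | nil => simp at hγ
  | cons e γ ih =>
    obtain ⟨rfl, h'⟩ := isPath_cons_iff.1 h
    by_cases hn : (γ.map E.s).Nodup
    · rw [List.map_cons, List.nodup_cons, not_and_or, not_not] at hγ
      have hmem := hγ.resolve_right (not_not.2 hn)
      obtain ⟨β, f, δ, rfl, hs, h₁, -⟩ := h'.exists_split hmem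
      refine ⟨[], e :: β, f :: δ, by simp, by simp, ⟨E.s e, .cons e h₁⟩, ?_⟩
      rw [List.map_append, List.nodup_append] at hn
      rw [List.map_cons, List.nodup_cons]
      exact ⟨fun hc => hn.2.2 _ hc (E.s f) (by simp) hs.symm, hn.1⟩
    · obtain ⟨α, β, δ, rfl, hβ⟩ := ih h' hn
      exact ⟨e :: α, β, δ, by simp, hβ⟩

theorem IsPath.exists_isCycle_of_card_lt [Fintype E₀] {u w : E₀} {γ : List E₁}
    (h : E.IsPath u γ w) (hγ : Fintype.card E₀ < γ.length) :
    ∃ α β δ, γ = α ++ β ++ δ ∧ E.IsCycle β := by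
  refine h.exists_isCycle fun hn => ?_
  have := hn.length_le_card
  rw [List.length_map] at this
  omega

/-- Two vertices connected by a path are connected by a path without repetitions. -/
theorem Reaches.exists_simple {u w : E₀} (h : E.Reaches u w) :
    ∃ α, E.IsPath u α w ∧ (α.map E.s).Nodup ∧ w ∉ α.map E.s := by
  obtain ⟨α, h⟩ := h
  induction h with
  | nil v => exact ⟨[], .nil v, by simp, by simp⟩
  | @cons e α w h ih =>
    obtain ⟨β, hβ, hn, hw⟩ := ih
    by_cases hew : w = E.s e
    · subst hew; exact ⟨[], .nil _, by simp, by simp⟩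
    by_cases hmem : E.s e ∈ β.map E.s
    · obtain ⟨β₁, f, β₂, rfl, hs, -, h₂⟩ := hβ.exists_split hmem
      rw [List.map_append, List.nodup_append] at hn
      rw [List.map_append, List.mem_append, not_or] at hw
      exact ⟨f :: β₂, h₂, hn.2.1, hw.2⟩
    · refine ⟨e :: β, .cons e hβ, ?_, ?_⟩
      · rw [List.map_cons, List.nodup_cons]; exact ⟨hmem, hn⟩
      · rw [List.map_cons, List.mem_cons, not_or]; exact ⟨hew, hw⟩

/-- An edge that closes up to a cycle. -/
theorem exists_isCycle_of_reaches {f : E₁} (h : E.Reaches (E.r f) (E.s f)) :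
    ∃ α, E.IsCycle (f :: α) := by
  obtain ⟨α, hα, hn, hw⟩ := h.exists_simple
  refine ⟨α, by simp, ⟨_, .cons f hα⟩, ?_⟩
  rw [List.map_cons, List.nodup_cons]
  exact ⟨hw, hn⟩

/-- Every edge that leaves a vertex of `ω` and can be continued to a closed path lies on `ω`. -/
def NoBranch (E : DirGraph E₀ E₁) (ω : List E₁) : Prop :=
  ∀ e ∈ ω, ∀ f, E.s f = E.s e → E.Reaches (E.r f) (E.s e) → f = e

/-- An edge that can return to its source closes up to a cycle. If this cycle is a rotation of `ω`,
the edge lies on `ω`, where edges are determined by their sources. -/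
theorem IsExclusiveCycle.noBranch {ω : List E₁} (h : E.IsExclusiveCycle ω) : E.NoBranch ω := by
  intro e he f hs hr
  rw [← hs] at hr
  obtain ⟨α, hα⟩ := exists_isCycle_of_reaches hr
  have hrot := h.2 _ hα ⟨E.s e, ⟨e, he, .inl rfl⟩, ⟨f, by simp, .inl hs⟩⟩
  have hf : f ∈ ω := hrot.mem_iff.2 (by simp)
  exact List.inj_on_of_nodup_map h.1.nodup hf he hs

/-- Rotated to start at a common vertex `x`, both cycles must take the same edge at every step, and
both stop at their first return to `x`. -/
theorem IsCycle.isExclusiveCycle {ω : List E₁} (hω : E.IsCycle ω) (hb : E.NoBranch ω) :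
    E.IsExclusiveCycle ω := by
  refine ⟨hω, fun ξ hξ => ?_⟩
  rintro ⟨x, hx, hx'⟩
  rw [hω.mem_vert_iff] at hx
  rw [hξ.mem_vert_iff] at hx'
  obtain ⟨e, α, hrω, he, hα, hxα⟩ := hω.exists_rotation hx
  obtain ⟨f, β, hrξ, hf, hβ, hxβ⟩ := hξ.exists_rotation hx'
  suffices h : e :: α = f :: β by
    rw [← h] at hrξ
    exact hrω.trans hrξ.symm
  have hmem : ∀ e' ∈ e :: α, e' ∈ ω := fun e' h => hrω.mem_iff.2 h
  have hfe : f = e := hb e (hmem e (by simp)) f (hf.trans he.symm) (he ▸ ⟨β, hβ⟩)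
  subst hfe
  have key : ∀ (α β : List E₁) (y : E₀), (∀ e' ∈ α, e' ∈ ω) → E.IsPath y α x → E.IsPath y β x →
      x ∉ α.map E.s → x ∉ β.map E.s → α = β := by
    intro α
    induction α with
    | nil =>
      intro β y _ h₁ h₂ _ hxβ
      by_contra hne
      rw [isPath_nil_iff] at h₁
      subst h₁
      exact hxβ (h₂.source_mem (Ne.symm hne))
    | cons a α ih =>
      intro β y hm h₁ h₂ hxα hxβ
      cases β with
      | nil =>
        rw [isPath_nil_iff] at h₂
        subst h₂
        exact absurd (h₁.source_mem (by simp)) hxα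
      | cons b β =>
        rw [isPath_cons_iff] at h₁ h₂
        have ha : a ∈ ω := hm a (by simp)
        have hba : b = a := hb a ha b (h₂.1.trans h₁.1.symm)
          (Reaches.trans ⟨β, h₂.2⟩ (hω.reaches hx (List.mem_map_of_mem ha)))
        subst hba
        rw [List.map_cons, List.mem_cons, not_or] at hxα hxβ
        rw [ih β _ (fun e' h => hm e' (by simp [h])) h₁.2 h₂.2 hxα.2 hxβ.2]
  rw [key α β _ (fun e' h => hmem e' (by simp [h])) hα hβ hxα hxβ]

/-- A path that starts on a branch-free cycle and can return to it stays on the cycle. -/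
theorem IsCycle.range_mem_of_isPath {ω : List E₁} (hω : E.IsCycle ω) (hb : E.NoBranch ω)
    {x y : E₀} {α : List E₁} (h : E.IsPath x α y) (hx : x ∈ ω.map E.s) {z : E₀}
    (hz : z ∈ ω.map E.s) (hyz : E.Reaches y z) : y ∈ ω.map E.s := by
  induction h with
  | nil v => exact hx
  | cons f h ih =>
    obtain ⟨e, he, hes⟩ := List.mem_map.1 hx
    have hfe : f = e := hb e he f hes.symm
      ((Reaches.trans ⟨_, h⟩ hyz).trans (hω.reaches hz (List.mem_map_of_mem he)))
    subst hfe
    exact ih (hω.range_mem he) hyz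

/-- Paths from a vertex of a branch-free cycle to a vertex of that cycle are determined by their
length. -/
theorem IsCycle.eq_of_isPath {ω : List E₁} (hω : E.IsCycle ω) (hb : E.NoBranch ω) {z : E₀}
    (hz : z ∈ ω.map E.s) {x : E₀} {α β : List E₁} (hα : E.IsPath x α z)
    (hβ : E.IsPath x β z) (hx : x ∈ ω.map E.s) (hl : α.length = β.length) : α = β := by
  induction α generalizing x β with
  | nil => exact (List.length_eq_zero_iff.1 hl.symm).symm
  | cons a α ih =>
    cases β with
    | nil => simp at hl
    | cons b β =>
      rw [isPath_cons_iff] at hα hβ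
      obtain ⟨e, he, rfl⟩ := List.mem_map.1 hx
      have hz' := hω.reaches hz hx
      have hae : a = e := hb e he a hα.1 (Reaches.trans ⟨_, hα.2⟩ hz')
      have hbe : b = e := hb e he b hβ.1 (Reaches.trans ⟨_, hβ.2⟩ hz')
      subst hae hbe
      rw [ih hα.2 hβ.2 (hω.range_mem he) (by simpa using hl)]

/-- A long path ending on an exclusive maximal cycle is determined by its length and its first
edges. -/
theorem IsMaximalCycle.eq_of_take_eq [Fintype E₀] {ω : List E₁} (hω : E.IsMaximalCycle ω)
    (hb : E.NoBranch ω) {z : E₀} (hz : z ∈ ω.map E.s) {u u' : E₀} {γ γ' : List E₁}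
    (hγ : E.IsPath u γ z) (hγ' : E.IsPath u' γ' z) (hl : γ.length = γ'.length)
    (ht : γ.take (Fintype.card E₀ + 1) = γ'.take (Fintype.card E₀ + 1)) : γ = γ' := by
  set d := Fintype.card E₀ + 1
  rcases le_or_gt γ.length d with h | h
  · rwa [List.take_of_length_le h, List.take_of_length_le (hl ▸ h)] at ht
  rw [← List.take_append_drop d γ, isPath_append_iff] at hγ
  rw [← List.take_append_drop d γ', ← ht, isPath_append_iff] at hγ'
  obtain ⟨y, h₁, h₂⟩ := hγ
  obtain ⟨y', h₁', h₂'⟩ := hγ'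
  have hlen : (γ.take d).length = d := by rw [List.length_take]; omega
  have hne : γ.take d ≠ [] := by
    rw [← List.length_pos_iff_ne_nil, hlen]; omega
  obtain rfl := h₁.range_unique hne h₁'
  -- The prefix is long enough to contain a cycle `β`. It reaches `ω`, so by maximality `ω` reaches
  -- `β`; without branches this round trip stays on `ω`, and so does the rest `δ` of the prefix.
  have hy : y ∈ ω.map E.s := by
    obtain ⟨α, β, δ, hd, hβ⟩ := h₁.exists_isCycle_of_card_lt (by omega)
    rw [hd, isPath_append_iff] at h₁
    obtain ⟨x, h₃, hδ⟩ := h₁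
    obtain ⟨x', hα, hβ'⟩ := isPath_append_iff.1 h₃
    obtain ⟨x'', hβ''⟩ := hβ.closed
    obtain rfl := hβ'.range_unique hβ.ne_nil hβ''
    have hxβ := hβ''.source_mem hβ.ne_nil
    have hxz : E.Reaches x z := Reaches.trans ⟨_, hδ⟩ ⟨_, h₂⟩
    obtain ⟨a, ha, b, hb', ⟨ε, hab⟩⟩ := hω.2 β hβ
      ⟨x, hβ.mem_vert_iff.2 hxβ, z, hω.1.mem_vert_iff.2 hz, hxz⟩
    rw [hω.1.mem_vert_iff] at ha
    rw [hβ.mem_vert_iff] at hb'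
    have hbω := hω.1.range_mem_of_isPath hb hab ha hz ((hβ.reaches hb' hxβ).trans hxz)
    obtain ⟨ε', hε'⟩ := hβ.reaches hb' hxβ
    have hxω := hω.1.range_mem_of_isPath hb hε' hbω hz hxz
    exact hω.1.range_mem_of_isPath hb hδ hxω hz ⟨_, h₂⟩
  rw [← List.take_append_drop d γ, ← List.take_append_drop d γ', ← ht]
  congr 1
  exact hω.1.eq_of_isPath hb hz h₂ h₂' hy (by simp [hl])

/-- If the closure of the cycles is not everything, then some vertex outside `V` is not reached
by any cycle. -/
theorem exists_not_reached [Fintype E₀] {V : Set E₀} (h : E.cycleClosure V ≠ Set.univ) :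
    ∃ v ∉ V, ∀ ω, E.IsCycle ω → ∀ x ∈ ω.map E.s, ¬ E.Reaches x v := by
  obtain ⟨hher, hsat, hcyc⟩ := (E.isLeast_cycleClosure V).1
  by_contra hcon
  push Not at hcon
  obtain ⟨v₀, hv₀⟩ := (Set.ne_univ_iff_exists_notMem _).1 h
  have hV : ∀ v ∉ E.cycleClosure V, v ∈ V := by
    intro v hv
    by_contra hvV
    obtain ⟨ω, hω, x, hx, hxv⟩ := hcon v hvV
    exact hv (hher x (hcyc ω hω (hω.mem_vert_iff.2 hx)) v hxv)
  -- Saturation allows one to walk on outside the closure indefinitely. A walk with more than `|E₀|`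
  -- edges contains a cycle, and heredity then puts its endpoint into the closure.
  have step : ∀ v ∉ E.cycleClosure V, ∃ e, E.s e = v ∧ E.r e ∉ E.cycleClosure V := by
    intro v hv
    by_contra hc
    push Not at hc
    refine hv (hsat v (hV v hv) ?_)
    rintro _ ⟨e, he, rfl⟩
    exact hc e he
  have long : ∀ n : ℕ, ∀ v ∉ E.cycleClosure V,
      ∃ α w, α.length = n ∧ E.IsPath v α w ∧ w ∉ E.cycleClosure V := by
    intro n
    induction n with
    | zero => intro v hv; exact ⟨[], v, rfl, .nil v, hv⟩
    | succ n ih =>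
      intro v hv
      obtain ⟨e, rfl, he⟩ := step v hv
      obtain ⟨α, w, hl, hp, hw⟩ := ih _ he
      exact ⟨e :: α, w, by simp [hl], .cons e hp, hw⟩
  obtain ⟨γ, w, hl, hp, hw⟩ := long (Fintype.card E₀ + 1) v₀ hv₀
  obtain ⟨α, β, δ, rfl, hβ⟩ := hp.exists_isCycle_of_card_lt (by omega)
  obtain ⟨x, hx, hδ⟩ := isPath_append_iff.1 hp
  obtain ⟨y, -, hyx⟩ := isPath_append_iff.1 hx
  exact hw (hher y (hcyc β hβ (hβ.mem_vert_iff.2 (hyx.source_mem hβ.ne_nil))) w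
    (Reaches.trans ⟨_, hyx⟩ ⟨_, hδ⟩))

/-- If no cycle is both exclusive and maximal, then above every vertex of every cycle there is a
vertex with two different edges that can be continued to closed paths. -/
theorem exists_branch [Finite E₀] (h : ¬ ∃ ω, E.IsExclusiveCycle ω ∧ E.IsMaximalCycle ω)
    {ω : List E₁} (hω : E.IsCycle ω) {w : E₀} (hw : w ∈ ω.map E.s) :
    ∃ e f, e ≠ f ∧ E.s e = E.s f ∧ E.Reaches (E.r e) (E.s e) ∧ E.Reaches (E.r f) (E.s e) ∧
      E.Reaches (E.s e) w := by
  let C : Set E₀ := {x | E.Reaches x w ∧ ∃ ξ, E.IsCycle ξ ∧ x ∈ ξ.map E.s}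
  -- Among the cycle vertices above `w`, choose one with the fewest vertices above it: no cycle can
  -- lie strictly above its cycle `ξ`.
  obtain ⟨u, ⟨huw, ξ, hξ, huξ⟩, hmin⟩ := C.toFinite.exists_minimalFor
    (fun x => {y | E.Reaches y x}.ncard) C ⟨w, Reaches.refl w, ω, hω, hw⟩
  have hmax : E.IsMaximalCycle ξ := by
    refine ⟨hξ, ?_⟩
    rintro η hη ⟨x, hx, y, hy, hxy⟩
    rw [hη.mem_vert_iff] at hx
    rw [hξ.mem_vert_iff] at hy
    have hxu : E.Reaches x u := hxy.trans (hξ.reaches hy huξ)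
    have hsub : {y | E.Reaches y x} ⊆ {y | E.Reaches y u} := fun y hy => Reaches.trans hy hxu
    have hle := hmin (j := x) ⟨hxu.trans huw, η, hη, hx⟩ (Set.ncard_le_ncard hsub)
    have heq := Set.eq_of_subset_of_ncard_le hsub hle
    have hux : E.Reaches u x := by
      have : u ∈ {y | E.Reaches y u} := Reaches.refl u
      rwa [← heq] at this
    exact ⟨u, hξ.mem_vert_iff.2 huξ, x, hη.mem_vert_iff.2 hx, hux⟩
  have hb : ¬ E.NoBranch ξ := fun hb => h ⟨ξ, hξ.isExclusiveCycle hb, hmax⟩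
  unfold NoBranch at hb
  push Not at hb
  obtain ⟨e, he, f, hs, hr, hne⟩ := hb
  have hes := List.mem_map_of_mem (f := E.s) he
  exact ⟨e, f, hne.symm, hs.symm, hξ.reaches (hξ.range_mem he) hes, hr,
    (hξ.reaches hes huξ).trans huw⟩

end DirGraph

/-! ### Epimorphisms between the right ideals of vertices. -/

namespace DirGraph

variable {E₀ : Type*} {E₁ : Type*}

/-- Elements of a ring that satisfy the defining relations of the relative Leavitt path algebra:
`p v` for the vertices, `a e` for the edges and `b e` for the ghost edges. -/
structure IsLeavittFamily [Fintype E₀] (E : DirGraph E₀ E₁) (V : Set E₀) {A : Type*} [Ring A]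
    (p : E₀ → A) (a b : E₁ → A) : Prop where
  vertex_idem (v : E₀) : p v * p v = p v
  vertex_orth (v w : E₀) (h : v ≠ w) : p v * p w = 0
  src_edge (e : E₁) : p (E.s e) * a e = a e
  edge_rng (e : E₁) : a e * p (E.r e) = a e
  sum_vertex : ∑ v, p v = 1
  rng_ghost (e : E₁) : p (E.r e) * b e = b e
  ghost_src (e : E₁) : b e * p (E.s e) = b e
  ghost_edge (e : E₁) : b e * a e = p (E.r e)
  ghost_edge_ne (e f : E₁) (h : e ≠ f) : b e * a f = 0
  sum_out (v : E₀) (hv : v ∈ V) (S : Finset E₁) (hS : ∀ e, e ∈ S ↔ E.s e = v) :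
    ∑ e ∈ S, a e * b e = p v

end DirGraph

/-- There is an epimorphism from `M` to `N`. -/
def MapsOnto (R M N : Type*) [Ring R] [AddCommGroup M] [Module R M] [AddCommGroup N]
    [Module R N] : Prop :=
  ∃ f : M →ₗ[R] N, Function.Surjective f

namespace MapsOnto

variable {R M N M' N' : Type*} [Ring R] [AddCommGroup M] [Module R M] [AddCommGroup N]
  [Module R N] [AddCommGroup M'] [Module R M'] [AddCommGroup N'] [Module R N']

theorem refl : MapsOnto R M M := ⟨LinearMap.id, Function.surjective_id⟩

theorem trans : MapsOnto R M N → MapsOnto R N N' → MapsOnto R M N' := by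
  rintro ⟨f, hf⟩ ⟨g, hg⟩
  exact ⟨g ∘ₗ f, hg.comp hf⟩

theorem of_equiv (e : M ≃ₗ[R] N) : MapsOnto R M N := ⟨e.toLinearMap, e.surjective⟩

theorem prodMap : MapsOnto R M N → MapsOnto R M' N' → MapsOnto R (M × M') (N × N') := by
  rintro ⟨f, hf⟩ ⟨g, hg⟩
  exact ⟨f.prodMap g, hf.prodMap hg⟩

theorem piMap {ι : Type*} {X Y : ι → Type*} [∀ i, AddCommGroup (X i)] [∀ i, Module R (X i)]
    [∀ i, AddCommGroup (Y i)] [∀ i, Module R (Y i)] (h : ∀ i, MapsOnto R (X i) (Y i)) :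
    MapsOnto R (∀ i, X i) (∀ i, Y i) := by
  choose f hf using h
  refine ⟨LinearMap.pi fun i => f i ∘ₗ LinearMap.proj i, fun y => ?_⟩
  choose g hg using fun i => hf i (y i)
  exact ⟨g, funext hg⟩

theorem proj {ι : Type*} {X : ι → Type*} [∀ i, AddCommGroup (X i)] [∀ i, Module R (X i)]
    (i : ι) : MapsOnto R (∀ i, X i) (X i) :=
  ⟨LinearMap.proj i, Function.surjective_eval i⟩

theorem restrict {ι : Type*} {X : ι → Type*} [∀ i, AddCommGroup (X i)] [∀ i, Module R (X i)]
    (T : ι → Prop) : MapsOnto R (∀ i, X i) (∀ i : Subtype T, X i) := by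
  classical
  refine ⟨LinearMap.pi fun i => LinearMap.proj i.1, fun y => ?_⟩
  refine ⟨fun i => if h : T i then y ⟨i, h⟩ else 0, funext fun i => ?_⟩
  simp [i.2]

/-- A module that maps onto its square maps onto all its finite powers. -/
theorem pi_of_prod (h : MapsOnto R M (M × M)) (ι : Type*) [Finite ι] :
    MapsOnto R M (ι → M) := by
  have key : ∀ n : ℕ, MapsOnto R M (Fin n → M) := by
    intro n
    induction n with
    | zero => exact ⟨0, fun y => ⟨0, Subsingleton.elim _ _⟩⟩
    | succ n ih =>
      exact (h.trans (refl.prodMap ih)).trans (of_equiv (Fin.consLinearEquiv R fun _ => M))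
  obtain ⟨n, ⟨e⟩⟩ := Finite.exists_equiv_fin ι
  exact (key n).trans (of_equiv (LinearEquiv.funCongrLeft R M e))

end MapsOnto

/-- The right ideal of all elements fixed by left multiplication with `p`; for an idempotent `p`
this is `pA`. -/
def fixedRightIdeal {A : Type*} [Ring A] (p : A) : Submodule Aᵐᵒᵖ A where
  carrier := {x | p * x = x}
  add_mem' {x y} hx hy := by
    simp only [Set.mem_ofPred_eq] at *
    rw [mul_add, hx, hy]
  zero_mem' := mul_zero p
  smul_mem' c x hx := by
    simp only [Set.mem_ofPred_eq, MulOpposite.smul_eq_mul_unop] at *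
    rw [← mul_assoc, hx]

theorem mem_fixedRightIdeal {A : Type*} [Ring A] {p x : A} :
    x ∈ fixedRightIdeal p ↔ p * x = x := Iff.rfl

namespace DirGraph.IsLeavittFamily

variable {E₀ E₁ : Type*} [Fintype E₀] {E : DirGraph E₀ E₁} {V : Set E₀} {A : Type*} [Ring A]
  {p : E₀ → A} {a b : E₁ → A}

theorem mapsOnto_pi_vertex (h : E.IsLeavittFamily V p a b) :
    MapsOnto Aᵐᵒᵖ A (∀ v, fixedRightIdeal (p v)) := by
  classical
  refine ⟨LinearMap.pi fun v => (LinearMap.mulLeft Aᵐᵒᵖ (p v)).codRestrict _ fun x => ?_,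
    fun y => ⟨∑ v, (y v : A), ?_⟩⟩
  · rw [mem_fixedRightIdeal, LinearMap.mulLeft_apply, ← mul_assoc, h.vertex_idem]
  · funext v
    apply Subtype.ext
    simp only [LinearMap.pi_apply, LinearMap.codRestrict_apply, LinearMap.mulLeft_apply,
      Finset.mul_sum]
    rw [Finset.sum_eq_single v]
    · exact (y v).2
    · intro w _ hw
      rw [← mem_fixedRightIdeal.1 (y w).2, ← mul_assoc, h.vertex_orth v w hw.symm, zero_mul]
    · simp

theorem pi_vertex_mapsOnto (h : E.IsLeavittFamily V p a b) :
    MapsOnto Aᵐᵒᵖ (∀ v, fixedRightIdeal (p v)) A := by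
  refine ⟨∑ v, (fixedRightIdeal (p v)).subtype ∘ₗ LinearMap.proj v, fun x =>
    ⟨fun v => ⟨p v * x, ?_⟩, ?_⟩⟩
  · rw [mem_fixedRightIdeal, ← mul_assoc, h.vertex_idem]
  · simp [LinearMap.sum_apply, ← Finset.sum_mul, h.sum_vertex]

/-- The right ideal of a vertex maps onto the sum of those of the ranges of finitely many edges
that it emits. -/
theorem vertex_mapsOnto_pi (h : E.IsLeavittFamily V p a b) (v : E₀) {ι : Type*} [Finite ι]
    (e : ι → E₁) (he : Function.Injective e) (hv : ∀ i, E.s (e i) = v) :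
    MapsOnto Aᵐᵒᵖ (fixedRightIdeal (p v)) (∀ i, fixedRightIdeal (p (E.r (e i)))) := by
  classical
  have := Fintype.ofFinite ι
  refine ⟨LinearMap.pi fun i => (LinearMap.mulLeft Aᵐᵒᵖ (b (e i)) ∘ₗ
    (fixedRightIdeal (p v)).subtype).codRestrict _ fun x => ?_,
    fun y => ⟨⟨∑ i, a (e i) * (y i : A), ?_⟩, ?_⟩⟩
  · simp [mem_fixedRightIdeal, ← mul_assoc, h.rng_ghost]
  · rw [mem_fixedRightIdeal, Finset.mul_sum]
    refine Finset.sum_congr rfl fun i _ => ?_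
    rw [← mul_assoc, ← hv i, h.src_edge]
  · funext i
    apply Subtype.ext
    change b (e i) * ∑ j, a (e j) * (y j : A) = y i
    rw [Finset.mul_sum, Finset.sum_eq_single i]
    · rw [← mul_assoc, h.ghost_edge]
      exact (y i).2
    · intro j _ hj
      rw [← mul_assoc, h.ghost_edge_ne _ _ fun hc => hj (he hc).symm, zero_mul]
    · simp

theorem vertex_mapsOnto_range (h : E.IsLeavittFamily V p a b) (e : E₁) :
    MapsOnto Aᵐᵒᵖ (fixedRightIdeal (p (E.s e))) (fixedRightIdeal (p (E.r e))) :=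
  (h.vertex_mapsOnto_pi _ (fun _ : Unit => e) (fun _ _ _ => rfl) fun _ => rfl).trans
    (.proj (X := fun _ : Unit => fixedRightIdeal (p (E.r e))) ())

theorem vertex_mapsOnto_of_reaches (h : E.IsLeavittFamily V p a b) {v w : E₀}
    (hvw : E.Reaches v w) :
    MapsOnto Aᵐᵒᵖ (fixedRightIdeal (p v)) (fixedRightIdeal (p w)) := by
  obtain ⟨α, hα⟩ := hvw
  induction hα with
  | nil v => exact .refl
  | cons e _ ih => exact (h.vertex_mapsOnto_range e).trans ih

/-- The map is `y ↦ ∑ a e * y e`. The Cuntz–Krieger relation at `v` makes `x ↦ (b e * x)` a right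
inverse. -/
theorem pi_mapsOnto_vertex (h : E.IsLeavittFamily V p a b) {v : E₀} (hv : v ∈ V)
    (S : Finset E₁) (hS : ∀ e, e ∈ S ↔ E.s e = v) :
    MapsOnto Aᵐᵒᵖ (∀ e : S, fixedRightIdeal (p (E.r e))) (fixedRightIdeal (p v)) := by
  have key : ∀ e : E₁, ∀ x : A, p (E.s e) * (a e * x) = a e * x := fun e x => by
    rw [← mul_assoc, h.src_edge]
  refine ⟨(∑ e : S, LinearMap.mulLeft Aᵐᵒᵖ (a e) ∘ₗ
    (fixedRightIdeal (p (E.r e))).subtype ∘ₗ LinearMap.proj e).codRestrict _ fun y => ?_,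
    fun x => ⟨fun e => ⟨b e * x, ?_⟩, ?_⟩⟩
  · rw [mem_fixedRightIdeal, LinearMap.sum_apply, Finset.mul_sum]
    refine Finset.sum_congr rfl fun e _ => ?_
    rw [← (hS e).1 e.2]
    exact key _ _
  · rw [mem_fixedRightIdeal, ← mul_assoc, h.rng_ghost]
  · apply Subtype.ext
    simp only [LinearMap.codRestrict_apply, LinearMap.sum_apply, LinearMap.comp_apply,
      LinearMap.proj_apply, Submodule.subtype_apply, LinearMap.mulLeft_apply, ← mul_assoc,
      ← Finset.sum_mul]
    rw [Finset.sum_coe_sort S fun e => a e * b e, h.sum_out v hv S hS]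
    exact x.2

/-- The two edges give an epimorphism onto the product of the ideals of their ranges, and the return
paths lead from either factor back to the ideal of `E.s e`. -/
theorem vertex_mapsOnto_prod (h : E.IsLeavittFamily V p a b) {e f : E₁} (hef : e ≠ f)
    (hs : E.s e = E.s f) (he : E.Reaches (E.r e) (E.s e)) (hf : E.Reaches (E.r f) (E.s e)) :
    MapsOnto Aᵐᵒᵖ (fixedRightIdeal (p (E.s e)))
      (fixedRightIdeal (p (E.s e)) × fixedRightIdeal (p (E.s e))) := by
  have h₁ := h.vertex_mapsOnto_pi (E.s e) ![e, f] (by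
    intro i j hij
    fin_cases i <;> fin_cases j <;> simp_all [hef.symm]) (by
    intro i; fin_cases i <;> simp [hs])
  refine h₁.trans ((MapsOnto.piMap (Y := fun _ => fixedRightIdeal (p (E.s e))) ?_).trans
    (.of_equiv (LinearEquiv.finTwoArrow Aᵐᵒᵖ _)))
  intro i
  fin_cases i
  · exact h.vertex_mapsOnto_of_reaches he
  · exact h.vertex_mapsOnto_of_reaches hf

/-- If the cycles generate all vertices and none of them is exclusive and maximal, then the
algebra maps onto its square. -/
theorem mapsOnto_prod_self (h : E.IsLeavittFamily V p a b) (hV : V ⊆ E.Reg)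
    (hX : E.cycleClosure V = Set.univ)
    (hω : ¬ ∃ ω, E.IsExclusiveCycle ω ∧ E.IsMaximalCycle ω) : MapsOnto Aᵐᵒᵖ A (A × A) := by
  let P : E₀ → Type _ := fun v => fixedRightIdeal (p v)
  let T : E₀ → Prop := fun v => MapsOnto Aᵐᵒᵖ (P v) (P v × P v)
  let τ := ∀ t : Subtype T, P t
  have hτ : MapsOnto Aᵐᵒᵖ τ (τ × τ) :=
    (MapsOnto.piMap (Y := fun t : Subtype T => P t × P t) fun t => t.2).trans
      ⟨{ toFun := fun y => (fun t => (y t).1, fun t => (y t).2)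
         map_add' := fun _ _ => rfl
         map_smul' := fun _ _ => rfl }, fun y => ⟨fun t => (y.1 t, y.2 t), rfl⟩⟩
  have hA : MapsOnto Aᵐᵒᵖ A τ := h.mapsOnto_pi_vertex.trans (.restrict T)
  let Z : Set E₀ := {w | MapsOnto Aᵐᵒᵖ τ (P w)}
  have hZ : Z ∈ E.HerSatSets V := by
    refine ⟨fun x hx v hv => MapsOnto.trans hx (h.vertex_mapsOnto_of_reaches hv), ?_, ?_⟩
    -- Each range gets its own copy of `τ`, which is possible because `v` emits only finitely many
    -- edges.
    · intro v hv hr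
      let S := (hV hv).2.toFinset
      have hS : ∀ e, e ∈ S ↔ E.s e = v := fun e => by simp [S]
      exact ((hτ.pi_of_prod S).trans (.piMap fun e => hr ⟨e, (hS e).1 e.2, rfl⟩)).trans
        (h.pi_mapsOnto_vertex hv S hS)
    · intro ω hc w hw
      rw [hc.mem_vert_iff] at hw
      obtain ⟨e, f, hef, hs, he, hf, hew⟩ := exists_branch hω hc hw
      have ht : T (E.s e) := h.vertex_mapsOnto_prod hef hs he hf
      exact (MapsOnto.proj (X := fun t : Subtype T => P t) ⟨E.s e, ht⟩).trans
        (h.vertex_mapsOnto_of_reaches hew)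
  have hall : ∀ w, MapsOnto Aᵐᵒᵖ τ (P w) := fun w => by
    have hw : w ∈ E.cycleClosure V := hX ▸ Set.mem_univ w
    exact (E.isLeast_cycleClosure V).2 hZ hw
  have hτA : MapsOnto Aᵐᵒᵖ τ A :=
    ((hτ.pi_of_prod E₀).trans (.piMap hall)).trans h.pi_vertex_mapsOnto
  exact (hA.trans hτ).trans (hτA.prodMap hτA)

end DirGraph.IsLeavittFamily

/-! ### Spans of paths and Følner subspaces. -/

namespace DirGraph

variable {E₀ E₁ : Type*}

/-- The paths with range `z`, edges in `F` and length in `I`. -/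
def pathsTo (E : DirGraph E₀ E₁) (F : Set E₁) (I : Set ℕ) (z : E₀) : Set (List E₁) :=
  {γ | (∀ e ∈ γ, e ∈ F) ∧ γ.length ∈ I ∧ ∃ u, E.IsPath u γ z}

end DirGraph

theorem List.finite_mem_length_le {α : Type*} {F : Set α} (hF : F.Finite) (n : ℕ) :
    {l : List α | (∀ x ∈ l, x ∈ F) ∧ l.length ≤ n}.Finite := by
  have := hF.to_subtype
  refine ((List.finite_length_le F n).image (List.map Subtype.val)).subset ?_
  rintro l ⟨h, hl⟩
  refine ⟨l.attachWith (· ∈ F) h, by simpa using hl, by simp⟩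

namespace DirGraph.IsLeavittFamily

variable {E₀ E₁ : Type*} [Fintype E₀] {E : DirGraph E₀ E₁} {V : Set E₀} {A : Type*} [Ring A]
  {p : E₀ → A} {a b : E₁ → A} {z : E₀} {q : A}

theorem vertex_mul_path (h : E.IsLeavittFamily V p a b) (hq : p z * q = q) {u : E₀}
    {γ : List E₁} (hγ : E.IsPath u γ z) :
    p u * ((γ.map a).prod * q) = (γ.map a).prod * q := by
  cases hγ with
  | nil => simpa using hq
  | cons e _ =>
    simp only [List.map_cons, List.prod_cons, ← mul_assoc, h.src_edge]

theorem vertex_mul_path_of_ne (h : E.IsLeavittFamily V p a b) (hq : p z * q = q) {u w : E₀}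
    {γ : List E₁} (hγ : E.IsPath u γ z) (hw : w ≠ u) : p w * ((γ.map a).prod * q) = 0 := by
  rw [← h.vertex_mul_path hq hγ, ← mul_assoc, h.vertex_orth w u hw, zero_mul]

theorem edge_mul_path_of_ne (h : E.IsLeavittFamily V p a b) (hq : p z * q = q) {u : E₀}
    {γ : List E₁} (hγ : E.IsPath u γ z) {f : E₁} (hf : E.r f ≠ u) :
    a f * ((γ.map a).prod * q) = 0 := by
  rw [← h.edge_rng f, mul_assoc, h.vertex_mul_path_of_ne hq hγ hf, mul_zero]

theorem ghost_mul_path (h : E.IsLeavittFamily V p a b) (hq : p z * q = q) {e : E₁}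
    {γ : List E₁} (hγ : E.IsPath (E.r e) γ z) :
    b e * (((e :: γ).map a).prod * q) = (γ.map a).prod * q := by
  rw [List.map_cons, List.prod_cons, mul_assoc, ← mul_assoc (b e), h.ghost_edge,
    h.vertex_mul_path hq hγ]

theorem ghost_mul_path_of_ne (h : E.IsLeavittFamily V p a b) {e f : E₁} (hf : f ≠ e)
    {γ : List E₁} : b f * (((e :: γ).map a).prod * q) = 0 := by
  rw [List.map_cons, List.prod_cons, mul_assoc, ← mul_assoc (b f), h.ghost_edge_ne f e hf,
    zero_mul]

end DirGraph.IsLeavittFamily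

section Spans

open DirGraph

variable (K : Type*) [Field K] {E₀ E₁ : Type*} {A : Type*} [Ring A] [Algebra K A]

/-- The span of `1`, all vertices, and all edges and ghost edges from `F`. -/
def generatorSpan (p : E₀ → A) (a b : E₁ → A) (F : Set E₁) : Submodule K A :=
  Submodule.span K ({1} ∪ Set.range p ∪ a '' F ∪ b '' F)

/-- The span of the elements `γ q` for `γ` in a set of paths. -/
def pathSpan (a : E₁ → A) (q : A) (Γ : Set (List E₁)) : Submodule K A :=
  Submodule.span K ((fun γ => (γ.map a).prod * q) '' Γ)

variable {K} {p : E₀ → A} {a b : E₁ → A}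

theorem generatorSpan_mono {F G : Set E₁} (h : F ⊆ G) :
    generatorSpan K p a b F ≤ generatorSpan K p a b G :=
  Submodule.span_mono (Set.union_subset_union (Set.union_subset_union_right _
    (Set.image_mono h)) (Set.image_mono h))

theorem one_le_generatorSpan (F : Set E₁) : 1 ≤ generatorSpan K p a b F :=
  Submodule.one_le.2 (Submodule.subset_span (by simp))

theorem generatorSpan_pow_mono {F G : Set E₁} (h : F ⊆ G) {m n : ℕ} (hmn : m ≤ n) :
    generatorSpan K p a b F ^ m ≤ generatorSpan K p a b G ^ n :=
  (pow_le_pow_left₀ bot_le (generatorSpan_mono h) m).trans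
    (pow_le_pow_right₀ (one_le_generatorSpan G) hmn)

/-- Each span contains `1`, so its powers grow with the exponent as well as with the edge set, and
any two elements fit into a common one. -/
theorem exists_mem_generatorSpan_pow
    (hgen : Algebra.adjoin K (Set.range p ∪ Set.range a ∪ Set.range b) = ⊤) (x : A) :
    ∃ (F : Finset E₁) (m : ℕ), x ∈ generatorSpan K p a b F ^ m := by
  classical
  have hx : x ∈ Algebra.adjoin K (Set.range p ∪ Set.range a ∪ Set.range b) := hgen ▸ trivial
  induction hx using Algebra.adjoin_induction with
  | mem x hx =>
    rcases hx with (⟨v, rfl⟩ | ⟨e, rfl⟩) | ⟨e, rfl⟩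
    · exact ⟨∅, 1, by rw [pow_one]; exact Submodule.subset_span (by simp)⟩
    · exact ⟨{e}, 1, by rw [pow_one]; exact Submodule.subset_span (by simp)⟩
    · exact ⟨{e}, 1, by rw [pow_one]; exact Submodule.subset_span (by simp)⟩
  | algebraMap c => exact ⟨∅, 0, by rw [pow_zero]; exact Submodule.algebraMap_mem c⟩
  | add x y _ _ hx hy =>
    obtain ⟨F, m, hF⟩ := hx
    obtain ⟨G, n, hG⟩ := hy
    exact ⟨F ∪ G, max m n, add_mem
      (generatorSpan_pow_mono (by simp) (le_max_left _ _) hF)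
      (generatorSpan_pow_mono (by simp) (le_max_right _ _) hG)⟩
  | mul x y _ _ hx hy =>
    obtain ⟨F, m, hF⟩ := hx
    obtain ⟨G, n, hG⟩ := hy
    refine ⟨F ∪ G, m + n, ?_⟩
    rw [pow_add]
    exact Submodule.mul_mem_mul (generatorSpan_pow_mono (by simp) le_rfl hF)
      (generatorSpan_pow_mono (by simp) le_rfl hG)

/-- A finite dimensional subspace involves only finitely many edges. The set `F₀` allows prescribed
edges, such as those of a cycle, to be included. -/
theorem exists_le_generatorSpan_pow
    (hgen : Algebra.adjoin K (Set.range p ∪ Set.range a ∪ Set.range b) = ⊤)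
    (U : Submodule K A) [FiniteDimensional K U] (F₀ : Finset E₁) :
    ∃ (F : Finset E₁) (m : ℕ), F₀ ⊆ F ∧ U ≤ generatorSpan K p a b F ^ m := by
  classical
  obtain ⟨s, rfl⟩ := (Submodule.fg_iff_finiteDimensional U).2 inferInstance
  choose F m hF using exists_mem_generatorSpan_pow (K := K) hgen
  refine ⟨F₀ ∪ s.biUnion F, s.sup m, Finset.subset_union_left, Submodule.span_le.2 fun x hx => ?_⟩
  refine generatorSpan_pow_mono ?_ (Finset.le_sup hx) (hF x)
  exact_mod_cast (Finset.subset_biUnion_of_mem F hx).trans Finset.subset_union_right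

theorem pathSpan_mono {q : A} {Γ Δ : Set (List E₁)} (h : Γ ⊆ Δ) :
    pathSpan K a q Γ ≤ pathSpan K a q Δ := Submodule.span_mono (Set.image_mono h)

theorem pathSpan_union {q : A} (Γ Δ : Set (List E₁)) :
    pathSpan K a q (Γ ∪ Δ) = pathSpan K a q Γ ⊔ pathSpan K a q Δ := by
  rw [pathSpan, Set.image_union, Submodule.span_union]; rfl

theorem finiteDimensional_pathSpan {q : A} {Γ : Set (List E₁)} (h : Γ.Finite) :
    FiniteDimensional K (pathSpan K a q Γ) :=
  FiniteDimensional.span_of_finite K (h.image _)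

theorem finrank_pathSpan_le {q : A} {Γ : Set (List E₁)} (h : Γ.Finite) :
    Module.finrank K (pathSpan K a q Γ) ≤ Γ.ncard := by
  classical
  have := (h.image fun γ => (γ.map a).prod * q).fintype
  refine (finrank_span_le_card _).trans ?_
  rw [← Set.ncard_eq_toFinset_card']
  exact Set.ncard_image_le h

/-- If it does not kill `γ q`, a vertex fixes it, an edge prolongs `γ`, and a ghost edge removes the
first edge of `γ`. The exception is a ghost edge meeting the empty path, which `hnil` handles. -/
theorem DirGraph.IsLeavittFamily.generatorSpan_mul_pathSpan_le [Fintype E₀]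
    {E : DirGraph E₀ E₁} {V : Set E₀} (h : E.IsLeavittFamily V p a b) {z : E₀} {q : A}
    (hq : p z * q = q) {F : Set E₁} {Γ Δ : Set (List E₁)}
    (hΓ : ∀ γ ∈ Γ, ∃ u, E.IsPath u γ z) (hΓΔ : Γ ⊆ Δ)
    (hcons : ∀ f ∈ F, ∀ γ ∈ Γ, E.IsPath (E.r f) γ z → f :: γ ∈ Δ)
    (htail : ∀ f γ, f :: γ ∈ Γ → γ ∈ Δ) (hnil : [] ∈ Γ → ∀ f ∈ F, b f * q = 0) :
    generatorSpan K p a b F * pathSpan K a q Γ ≤ pathSpan K a q Δ := by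
  rw [generatorSpan, pathSpan, Submodule.span_mul_span, Submodule.span_le]
  have hmem : ∀ γ ∈ Δ, (γ.map a).prod * q ∈ pathSpan K a q Δ := fun γ hγ =>
    Submodule.subset_span ⟨γ, hγ, rfl⟩
  rintro _ ⟨x, hx, _, ⟨γ, hγ, rfl⟩, rfl⟩
  obtain ⟨u, hu⟩ := hΓ γ hγ
  change x * ((γ.map a).prod * q) ∈ pathSpan K a q Δ
  rcases hx with ((rfl | ⟨w, rfl⟩) | ⟨f, hf, rfl⟩) | ⟨f, hf, rfl⟩
  · rw [one_mul]
    exact hmem γ (hΓΔ hγ)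
  · by_cases hwu : w = u
    · rw [hwu, h.vertex_mul_path hq hu]
      exact hmem γ (hΓΔ hγ)
    · rw [h.vertex_mul_path_of_ne hq hu hwu]
      exact zero_mem _
  · by_cases hfu : E.r f = u
    · rw [← mul_assoc, ← List.prod_cons, ← List.map_cons]
      exact hmem _ (hcons f hf γ hγ (hfu ▸ hu))
    · rw [h.edge_mul_path_of_ne hq hu hfu]
      exact zero_mem _
  · cases γ with
    | nil =>
      rw [List.map_nil, List.prod_nil, one_mul, hnil hγ f hf]
      exact zero_mem _
    | cons e γ =>
      by_cases hfe : f = e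
      · rw [hfe, h.ghost_mul_path hq (isPath_cons_iff.1 hu).2]
        exact hmem _ (htail e γ hγ)
      · rw [h.ghost_mul_path_of_ne hfe]
        exact zero_mem _

end Spans

namespace DirGraph

variable {K : Type*} [Field K] {E₀ E₁ : Type*} [Fintype E₀] {E : DirGraph E₀ E₁} {V : Set E₀}
  {A : Type*} [Ring A] [Algebra K A] {p : E₀ → A} {a b : E₁ → A}

omit [Fintype E₀] in
theorem finite_pathsTo {F : Set E₁} (hF : F.Finite) {I : Set ℕ} (hI : BddAbove I) (z : E₀) :
    (E.pathsTo F I z).Finite := by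
  obtain ⟨n, hn⟩ := hI
  exact (List.finite_mem_length_le hF n).subset fun γ hγ => ⟨hγ.1, hn hγ.2.1⟩

/-- The defect of the Cuntz–Krieger relation at `z` with respect to the edges in `F`. -/
noncomputable def vertexDefect (E : DirGraph E₀ E₁) (p : E₀ → A) (a b : E₁ → A) (F : Finset E₁)
    (z : E₀) : A := by
  classical exact p z - ∑ e ∈ F with E.s e = z, a e * b e

theorem IsLeavittFamily.vertex_mul_vertexDefect (h : E.IsLeavittFamily V p a b) (F : Finset E₁)
    (z : E₀) : p z * E.vertexDefect p a b F z = E.vertexDefect p a b F z := by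
  classical
  rw [vertexDefect, mul_sub, h.vertex_idem, Finset.mul_sum]
  congr 1
  refine Finset.sum_congr rfl fun e he => ?_
  rw [← (Finset.mem_filter.1 he).2, ← mul_assoc, h.src_edge]

/-- If `f` starts at `z`, only the summand `e = f` survives and it cancels `b f * p z`. Otherwise `b
f * p z = 0` already. -/
theorem IsLeavittFamily.ghost_mul_vertexDefect (h : E.IsLeavittFamily V p a b) {F : Finset E₁}
    (z : E₀) {f : E₁} (hf : f ∈ F) : b f * E.vertexDefect p a b F z = 0 := by
  classical
  by_cases hs : E.s f = z
  · rw [vertexDefect, mul_sub, Finset.mul_sum, Finset.sum_eq_single f]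
    · rw [← mul_assoc, h.ghost_edge, h.rng_ghost, ← hs, h.ghost_src, sub_self]
    · intro e _ he
      rw [← mul_assoc, h.ghost_edge_ne f e he.symm, zero_mul]
    · intro hc
      exact absurd (Finset.mem_filter.2 ⟨hf, hs⟩) hc
  · rw [← h.vertex_mul_vertexDefect, ← h.ghost_src f, ← mul_assoc, mul_assoc (b f),
      h.vertex_orth _ _ hs, mul_zero, zero_mul]

/-- A vertex that is reached by no cycle and whose Cuntz–Krieger relation fails yields invariant
finite dimensional subspaces. -/
theorem IsLeavittFamily.amenable_of_not_reached (h : E.IsLeavittFamily V p a b)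
    (hgen : Algebra.adjoin K (Set.range p ∪ Set.range a ∪ Set.range b) = ⊤) {z : E₀}
    (hz : ∀ ω, E.IsCycle ω → ∀ x ∈ ω.map E.s, ¬ E.Reaches x z)
    (hne : ∀ F : Finset E₁, E.vertexDefect p a b F z ≠ 0) : AmenableAlgebra K A := by
  intro U _ c hc
  obtain ⟨F, m, -, hU⟩ := exists_le_generatorSpan_pow hgen U ∅
  set q := E.vertexDefect p a b F z
  have hq : p z * q = q := h.vertex_mul_vertexDefect F z
  let Γ := E.pathsTo F Set.univ z
  -- A path with more than `|E₀|` edges would contain a cycle reaching `z`.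
  have hΓ : Γ.Finite := by
    refine (finite_pathsTo (E := E) F.finite_toSet (I := Set.Iic (Fintype.card E₀)) bddAbove_Iic
      z).subset ?_
    rintro γ ⟨h₁, -, u, hu⟩
    refine ⟨h₁, ?_, u, hu⟩
    by_contra hlen
    obtain ⟨α, β, δ, rfl, hβ⟩ := hu.exists_isCycle_of_card_lt (not_le.1 hlen)
    obtain ⟨x, hx, hδ⟩ := isPath_append_iff.1 hu
    obtain ⟨y, -, hyx⟩ := isPath_append_iff.1 hx
    exact hz β hβ y (hyx.source_mem hβ.ne_nil) (Reaches.trans ⟨_, hyx⟩ ⟨_, hδ⟩)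
  have hW := finiteDimensional_pathSpan (K := K) (a := a) (q := q) hΓ
  have hstep : generatorSpan K p a b F * pathSpan K a q Γ ≤ pathSpan K a q Γ := by
    refine h.generatorSpan_mul_pathSpan_le hq (fun γ hγ => hγ.2.2) subset_rfl ?_ ?_
      fun _ f hf => h.ghost_mul_vertexDefect z hf
    · rintro f hf γ ⟨h₁, -, -⟩ hγ
      exact ⟨List.forall_mem_cons.2 ⟨hf, h₁⟩, trivial, _, .cons f hγ⟩
    · rintro f γ ⟨h₁, -, u, hu⟩
      exact ⟨(List.forall_mem_cons.1 h₁).2, trivial, _, (isPath_cons_iff.1 hu).2⟩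
  have hpow : ∀ n : ℕ, generatorSpan K p a b F ^ n * pathSpan K a q Γ ≤ pathSpan K a q Γ := by
    intro n
    induction n with
    | zero => rw [pow_zero, one_mul]
    | succ n ih =>
      rw [pow_succ, mul_assoc]
      exact (mul_le_mul' le_rfl hstep).trans ih
  have hle : Module.finrank K (U * pathSpan K a q Γ : Submodule K A) ≤
      Module.finrank K (pathSpan K a q Γ) :=
    Submodule.finrank_mono ((mul_le_mul' hU le_rfl).trans (hpow m))
  have hpos : 0 < Module.finrank K (pathSpan K a q Γ) := by
    have hqm : q ∈ pathSpan K a q Γ :=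
      Submodule.subset_span ⟨[], ⟨by simp, trivial, z, .nil z⟩, by simp⟩
    have : Nontrivial (pathSpan K a q Γ) := ⟨⟨q, hqm⟩, 0, fun hc => hne F (congrArg Subtype.val hc)⟩
    exact Module.finrank_pos
  refine ⟨_, hW, ?_⟩
  have h₁ : (Module.finrank K (U * pathSpan K a q Γ : Submodule K A) : ℝ) ≤
      Module.finrank K (pathSpan K a q Γ) := by exact_mod_cast hle
  have h₂ : (0 : ℝ) < Module.finrank K (pathSpan K a q Γ) := by exact_mod_cast hpos
  nlinarith

theorem pathsTo_union {F : Set E₁} {I J : Set ℕ} {z : E₀} :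
    E.pathsTo F (I ∪ J) z = E.pathsTo F I z ∪ E.pathsTo F J z := by
  ext γ
  simp only [pathsTo, Set.mem_union, Set.mem_ofPred_eq]
  tauto

/-- The number of paths of any given length that end on an exclusive maximal cycle is bounded. -/
theorem IsMaximalCycle.exists_ncard_pathsTo_le {ω : List E₁} (hω : E.IsMaximalCycle ω)
    (hb : E.NoBranch ω) {z : E₀} (hz : z ∈ ω.map E.s) {F : Set E₁} (hF : F.Finite) :
    ∃ C : ℕ, ∀ n : ℕ, (E.pathsTo F {n} z).ncard ≤ C := by
  refine ⟨_, fun n => Set.ncard_le_ncard_of_injOn (List.take (Fintype.card E₀ + 1)) ?_ ?_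
    (List.finite_mem_length_le hF (Fintype.card E₀ + 1))⟩
  · rintro γ ⟨h₁, -⟩
    exact ⟨fun e he => h₁ e (List.mem_of_mem_take he), by simp⟩
  · rintro γ ⟨-, hl, u, hu⟩ γ' ⟨-, hl', u', hu'⟩ ht
    exact hω.eq_of_take_eq hb hz hu hu' (hl.trans hl'.symm) ht

theorem finrank_pathSpan_pathsTo_le {F : Set E₁} (hF : F.Finite) {z : E₀} {q : A} {C : ℕ}
    (hC : ∀ n : ℕ, (E.pathsTo F {n} z).ncard ≤ C) (I : Finset ℕ) :
    Module.finrank K (pathSpan K a q (E.pathsTo F I z)) ≤ I.card * C := by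
  classical
  induction I using Finset.induction_on with
  | empty =>
    have : E.pathsTo F (∅ : Finset ℕ) z = ∅ := by
      ext γ; simp [pathsTo]
    rw [this, pathSpan, Set.image_empty, Submodule.span_empty, finrank_bot]
    exact Nat.zero_le _
  | insert n I hn ih =>
    have h₁ := finite_pathsTo (E := E) hF (I := {n}) (bddAbove_singleton) z
    have h₂ := finite_pathsTo (E := E) hF (I := I) I.bddAbove z
    have := finiteDimensional_pathSpan (K := K) (a := a) (q := q) h₁
    have := finiteDimensional_pathSpan (K := K) (a := a) (q := q) h₂
    rw [Finset.coe_insert, Set.insert_eq, pathsTo_union, pathSpan_union,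
      Finset.card_insert_of_notMem hn]
    have h₃ := Submodule.finrank_add_le_finrank_add_finrank
      (pathSpan K a q (E.pathsTo F {n} z)) (pathSpan K a q (E.pathsTo F I z))
    have h₄ := (finrank_pathSpan_le (K := K) (a := a) (q := q) h₁).trans (hC n)
    rw [add_mul, one_mul]
    omega

/-- Each factor changes lengths by at most one. The window starts at `j + i`, so that no ghost edge
meets the empty path and no defect is needed in place of `p z`. -/
theorem IsLeavittFamily.generatorSpan_pow_mul_pathSpan_le (h : E.IsLeavittFamily V p a b)
    (F : Set E₁) (z : E₀) (i j k : ℕ) :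
    generatorSpan K p a b F ^ i * pathSpan K a (p z) (E.pathsTo F (Finset.Icc (j + i) k) z) ≤
      pathSpan K a (p z) (E.pathsTo F (Finset.Icc j (k + i)) z) := by
  induction i generalizing j with
  | zero => simp
  | succ i ih =>
    rw [pow_succ', mul_assoc, show j + (i + 1) = (j + 1) + i by ring]
    refine (mul_le_mul' le_rfl (ih (j + 1))).trans ?_
    refine h.generatorSpan_mul_pathSpan_le (h.vertex_idem z) (fun γ hγ => hγ.2.2) ?_ ?_ ?_ ?_
    · rintro γ ⟨h₁, hl, hr⟩
      refine ⟨h₁, ?_, hr⟩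
      simp only [Finset.coe_Icc, Set.mem_Icc] at hl ⊢
      omega
    · rintro f hf γ ⟨h₁, hl, -⟩ hγ
      refine ⟨List.forall_mem_cons.2 ⟨hf, h₁⟩, ?_, _, .cons f hγ⟩
      simp only [Finset.coe_Icc, Set.mem_Icc, List.length_cons] at hl ⊢
      omega
    · rintro f γ ⟨h₁, hl, u, hu⟩
      refine ⟨(List.forall_mem_cons.1 h₁).2, ?_, _, (isPath_cons_iff.1 hu).2⟩
      simp only [Finset.coe_Icc, Set.mem_Icc, List.length_cons] at hl ⊢
      omega
    · rintro ⟨-, hl, -⟩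
      simp at hl

/-- An exclusive maximal cycle yields a Følner sequence. -/
theorem IsLeavittFamily.amenable_of_isMaximalCycle (h : E.IsLeavittFamily V p a b)
    (hgen : Algebra.adjoin K (Set.range p ∪ Set.range a ∪ Set.range b) = ⊤) {ω : List E₁}
    (hω : E.IsMaximalCycle ω) (hb : E.NoBranch ω)
    (hli : ∀ (z : E₀) (γ : ℕ → List E₁), (∀ n, (γ n).length = n ∧ ∃ u, E.IsPath u (γ n) z) →
      LinearIndependent K fun n => ((γ n).map a).prod * p z) : AmenableAlgebra K A := by
  classical
  intro U _ c hc
  obtain ⟨F, m, hωF, hU⟩ := exists_le_generatorSpan_pow hgen U ω.toFinset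
  obtain ⟨e₀, he₀⟩ := List.exists_mem_of_ne_nil ω hω.1.ne_nil
  set z := E.s e₀
  have hz : z ∈ ω.map E.s := List.mem_map_of_mem he₀
  obtain ⟨C, hC⟩ := hω.exists_ncard_pathsTo_le hb hz F.finite_toSet
  -- Walking backwards around `ω` gives a path to `z` of every length; `F` was chosen to contain the
  -- edges of `ω`.
  have hpath : ∀ n : ℕ, ∃ γ : List E₁, (γ.length = n ∧ ∀ e ∈ γ, e ∈ F) ∧
      ∃ u ∈ ω.map E.s, E.IsPath u γ z := by
    intro n
    induction n with
    | zero => exact ⟨[], by simp, z, hz, .nil z⟩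
    | succ n ih =>
      obtain ⟨γ, ⟨hl, hF⟩, u, hu, hγ⟩ := ih
      obtain ⟨e, he, rfl⟩ := hω.1.exists_edge_to hu
      exact ⟨e :: γ, ⟨by simp [hl], List.forall_mem_cons.2 ⟨hωF (List.mem_toFinset.2 he), hF⟩⟩,
        _, List.mem_map_of_mem he, .cons e hγ⟩
  choose γ hγ u _ hu using hpath
  have hlin := hli z γ fun n => ⟨(hγ n).1, u n, hu n⟩
  let W : Finset ℕ → Submodule K A := fun I => pathSpan K a (p z) (E.pathsTo F I z)
  have hfin : ∀ I, FiniteDimensional K (W I) := fun I =>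
    finiteDimensional_pathSpan (finite_pathsTo F.finite_toSet I.bddAbove z)
  have hlow : ∀ I, I.card ≤ Module.finrank K (W I) := by
    intro I
    have hI := hlin.comp (Subtype.val : I → ℕ) Subtype.val_injective
    have hcard := finrank_span_eq_card hI
    rw [Fintype.card_coe] at hcard
    rw [← hcard]
    refine Submodule.finrank_mono (Submodule.span_le.2 ?_)
    rintro _ ⟨n, rfl⟩
    refine Submodule.subset_span ⟨γ n, ⟨(hγ n).2, ?_, u n, hu n⟩, rfl⟩
    rw [(hγ n).1]
    exact n.2
  -- The boundary consists of at most `m` lengths on either side of the window, with at most `C`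
  -- paths each; `k` makes `2 * m * C` smaller than `(c - 1) * k`.
  obtain ⟨k, hk⟩ := exists_nat_gt ((2 * m * C : ℕ) / (c - 1))
  rw [div_lt_iff₀ (by linarith)] at hk
  have hsub : U * W (Finset.Icc m (m + k)) ≤
      W (Finset.Icc m (m + k)) ⊔ W (Finset.range m ∪ Finset.Ioc (m + k) (m + k + m)) := by
    have h₁ := h.generatorSpan_pow_mul_pathSpan_le (K := K) F z m 0 (m + k)
    rw [zero_add] at h₁
    refine ((mul_le_mul' hU le_rfl).trans h₁).trans ?_
    simp only [W]
    rw [← pathSpan_union, ← pathsTo_union]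
    refine pathSpan_mono ?_
    rintro α ⟨h₁, hl, hr⟩
    refine ⟨h₁, ?_, hr⟩
    simp only [Finset.coe_Icc, Set.mem_Icc, Finset.coe_union, Finset.coe_range, Finset.coe_Ioc,
      Set.mem_union, Set.mem_Iio, Set.mem_Ioc] at hl ⊢
    omega
  have hup := (Submodule.finrank_mono hsub).trans
    (Submodule.finrank_add_le_finrank_add_finrank _ _)
  have hbd : Module.finrank K (W (Finset.range m ∪ Finset.Ioc (m + k) (m + k + m))) ≤
      2 * m * C := by
    refine (finrank_pathSpan_pathsTo_le F.finite_toSet hC _).trans (Nat.mul_le_mul_right _ ?_)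
    refine (Finset.card_union_le _ _).trans ?_
    simp only [Finset.card_range, Nat.card_Ioc]
    omega
  have hlowk : k ≤ Module.finrank K (W (Finset.Icc m (m + k))) := by
    refine le_trans ?_ (hlow _)
    simp only [Nat.card_Icc]
    omega
  refine ⟨W (Finset.Icc m (m + k)), hfin _, ?_⟩
  have h₁ : (Module.finrank K (U * W (Finset.Icc m (m + k)) : Submodule K A) : ℝ) ≤
      Module.finrank K (W (Finset.Icc m (m + k))) + (2 * m * C : ℕ) := by
    exact_mod_cast hup.trans (Nat.add_le_add_left hbd _)
  have h₂ : (k : ℝ) ≤ Module.finrank K (W (Finset.Icc m (m + k))) := by exact_mod_cast hlowk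
  nlinarith

end DirGraph

/-! ### A representation by partial maps of a set. -/

section Representation

/-- The endomorphism of the free module on `Y` induced by a partial map. -/
noncomputable def partialMapEnd (K : Type*) [Field K] {Y : Type*} (f : Y → Option Y) :
    Module.End K (Y →₀ K) :=
  Finsupp.linearCombination K fun y => (f y).elim 0 fun y' => Finsupp.single y' 1

variable {K : Type*} [Field K] {Y : Type*}

theorem partialMapEnd_single (f : Y → Option Y) (y : Y) :
    partialMapEnd K f (Finsupp.single y 1) = (f y).elim 0 fun y' => Finsupp.single y' 1 := by
  simp [partialMapEnd]

theorem partialMapEnd_single_of_some {f : Y → Option Y} {y y' : Y} (h : f y = some y') :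
    partialMapEnd K f (Finsupp.single y 1) = Finsupp.single y' 1 := by
  rw [partialMapEnd_single, h]; rfl

theorem partialMapEnd_single_of_none {f : Y → Option Y} {y : Y} (h : f y = none) :
    partialMapEnd K f (Finsupp.single y 1) = 0 := by
  rw [partialMapEnd_single, h]; rfl

theorem end_ext_single {f g : Module.End K (Y →₀ K)}
    (h : ∀ y, f (Finsupp.single y 1) = g (Finsupp.single y 1)) : f = g :=
  Finsupp.lhom_ext' fun y => LinearMap.ext_ring (h y)

/-- Reduces most Leavitt relations to identities between partial maps. -/
theorem partialMapEnd_mul (f g : Y → Option Y) :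
    partialMapEnd K f * partialMapEnd K g = partialMapEnd K fun y => (g y).bind f := by
  refine end_ext_single fun y => ?_
  rw [Module.End.mul_apply, partialMapEnd_single, partialMapEnd_single]
  cases h : g y with
  | none => simp
  | some y' => simp [partialMapEnd_single]

theorem partialMapEnd_none : partialMapEnd K (fun _ : Y => none) = 0 :=
  end_ext_single fun y => by rw [partialMapEnd_single_of_none rfl, LinearMap.zero_apply]

namespace DirGraph

variable {E₀ E₁ : Type*}

open Cardinal in
/-- A family of injections of an infinite set `B` such that those that belong to the edges with a
common source `v` have disjoint images, which cover `B` if and only if `v ∈ V`. -/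
theorem exists_branching (E : DirGraph E₀ E₁) {V : Set E₀} (hV : V ⊆ E.Reg) :
    ∃ φ : E₁ → E₁ ⊕ ℕ → E₁ ⊕ ℕ,
      (∀ e f x y, E.s e = E.s f → φ e x = φ f y → e = f ∧ x = y) ∧
      (∀ v ∈ V, ∀ x, ∃ e y, E.s e = v ∧ φ e y = x) ∧
      (∀ v ∉ V, ∃ x, ∀ e y, E.s e = v → φ e y ≠ x) := by
  classical
  let B := E₁ ⊕ ℕ
  have hB : ℵ₀ ≤ #B := Cardinal.aleph0_le_mk B
  have hle : ∀ v, #{e // E.s e = v} ≤ #B := fun v =>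
    Cardinal.mk_le_of_injective (f := fun e => Sum.inl e.1) fun e f h =>
      Subtype.ext (Sum.inl.inj h)
  have key : ∀ v, ∃ g : {e // E.s e = v} × B → B, Function.Injective g ∧
      (v ∈ V → Function.Surjective g) ∧ (v ∉ V → ∃ x, ∀ y, g y ≠ x) := by
    intro v
    by_cases hv : v ∈ V
    · obtain ⟨⟨e, he⟩, -⟩ := hV hv
      have hcard : #({e // E.s e = v} × B) = #B := by
        rw [Cardinal.mk_prod, Cardinal.lift_id, Cardinal.lift_id]
        refine Cardinal.mul_eq_right hB (hle v) ?_
        exact Cardinal.mk_ne_zero_iff.2 ⟨⟨e, he⟩⟩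
      obtain ⟨g⟩ := Cardinal.eq.1 hcard
      exact ⟨g, g.injective, fun _ => g.surjective, fun h => absurd hv h⟩
    -- The additional element `none` reserves a point of `B` outside all images.
    · have hcard : #(Option ({e // E.s e = v} × B)) ≤ #B := by
        rw [Cardinal.mk_option, Cardinal.mk_prod, Cardinal.lift_id, Cardinal.lift_id]
        refine Cardinal.add_le_of_le hB ?_ (Cardinal.one_le_aleph0.trans hB)
        exact (mul_le_mul' (hle v) le_rfl).trans (Cardinal.mul_eq_self hB).le
      obtain ⟨g⟩ := hcard
      exact ⟨fun y => g (some y), fun x y h => Option.some_injective _ (g.injective h),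
        fun h => absurd h hv, fun _ => ⟨g none, fun y h => by simpa using g.injective h⟩⟩
  choose g hinj hsurj hmiss using key
  have hg : ∀ v e (he : E.s e = v) x, g (E.s e) (⟨e, rfl⟩, x) = g v (⟨e, he⟩, x) := by
    rintro v e rfl x; rfl
  refine ⟨fun e x => g (E.s e) (⟨e, rfl⟩, x), ?_, ?_, ?_⟩
  · intro e f x y hs h
    simp only [hg (E.s f) e hs] at h
    have := hinj _ h
    simp only [Prod.mk.injEq, Subtype.mk.injEq] at this
    exact this
  · intro v hv x
    obtain ⟨⟨⟨e, he⟩, y⟩, hy⟩ := hsurj v hv x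
    exact ⟨e, y, he, (hg v e he y).trans hy⟩
  · intro v hv
    obtain ⟨x, hx⟩ := hmiss v hv
    exact ⟨x, fun e y he => by simp only [hg v e he]; exact hx _⟩

section

variable (E : DirGraph E₀ E₁) {B : Type*} (φ : E₁ → B → B)

open Classical in
/-- The partial map by which a vertex acts. -/
noncomputable def vertexMap (v : E₀) (y : E₀ × B × ℤ) : Option (E₀ × B × ℤ) :=
  if y.1 = v then some y else none

open Classical in
/-- The partial map by which an edge acts. -/
noncomputable def edgeMap (e : E₁) (y : E₀ × B × ℤ) : Option (E₀ × B × ℤ) :=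
  if y.1 = E.r e then some (E.s e, φ e y.2.1, y.2.2 + 1) else none

open Classical in
/-- The partial map by which a ghost edge acts. -/
noncomputable def ghostMap (e : E₁) (y : E₀ × B × ℤ) : Option (E₀ × B × ℤ) :=
  if y.1 = E.s e then (Function.partialInv (φ e) y.2.1).map fun x => (E.r e, x, y.2.2 - 1)
  else none

variable {E φ}

theorem partialInv_branching (hφ : ∀ e f x y, E.s e = E.s f → φ e x = φ f y → e = f ∧ x = y)
    (e : E₁) (x : B) : Function.partialInv (φ e) (φ e x) = some x :=
  Function.partialInv_left (fun x y h => (hφ e e x y rfl h).2) x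

theorem partialInv_eq_none {e : E₁} {x : B} (h : ∀ y, φ e y ≠ x) :
    Function.partialInv (φ e) x = none := by
  rw [Function.partialInv, dif_neg]
  rintro ⟨y, hy⟩
  exact h y hy

/-- The edge `e` carries the copy of `B` at `E.r e` into the copy at `E.s e` by `φ e`, and the ghost
edge inverts this on the image. Disjointness of images gives `ghost_edge_ne`, covering gives
`sum_out`. -/
theorem isLeavittFamily_partialMapEnd [Fintype E₀] {V : Set E₀}
    (hφ : ∀ e f x y, E.s e = E.s f → φ e x = φ f y → e = f ∧ x = y)
    (hV : ∀ v ∈ V, ∀ x, ∃ e y, E.s e = v ∧ φ e y = x) :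
    E.IsLeavittFamily V (fun v => partialMapEnd K (vertexMap (B := B) v))
      (fun e => partialMapEnd K (E.edgeMap φ e)) (fun e => partialMapEnd K (E.ghostMap φ e)) where
  vertex_idem v := by
    rw [partialMapEnd_mul]; congr 1; funext y
    by_cases h : y.1 = v <;> simp [vertexMap, h]
  vertex_orth v w hvw := by
    rw [partialMapEnd_mul, ← partialMapEnd_none]; congr 1; funext y
    by_cases h : y.1 = w <;> simp [vertexMap, h, hvw.symm]
  src_edge e := by
    rw [partialMapEnd_mul]; congr 1; funext y
    by_cases h : y.1 = E.r e <;> simp [vertexMap, edgeMap, h]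
  edge_rng e := by
    rw [partialMapEnd_mul]; congr 1; funext y
    by_cases h : y.1 = E.r e <;> simp [vertexMap, edgeMap, h]
  sum_vertex := by
    refine end_ext_single fun y => ?_
    rw [LinearMap.sum_apply, Finset.sum_eq_single y.1]
    · exact partialMapEnd_single_of_some (by simp [vertexMap])
    · intro v _ hv
      exact partialMapEnd_single_of_none (by simp [vertexMap, hv.symm])
    · simp
  rng_ghost e := by
    rw [partialMapEnd_mul]; congr 1; funext y
    by_cases h : y.1 = E.s e
    · cases h' : Function.partialInv (φ e) y.2.1 <;> simp [vertexMap, ghostMap, h, h']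
    · simp [ghostMap, h]
  ghost_src e := by
    rw [partialMapEnd_mul]; congr 1; funext y
    by_cases h : y.1 = E.s e <;> simp [vertexMap, ghostMap, h]
  ghost_edge e := by
    rw [partialMapEnd_mul]; congr 1; funext ⟨w, x, k⟩
    by_cases h : w = E.r e
    · simp [vertexMap, edgeMap, ghostMap, h, partialInv_branching hφ]
    · simp [vertexMap, edgeMap, h]
  ghost_edge_ne e f hef := by
    rw [partialMapEnd_mul, ← partialMapEnd_none]; congr 1; funext ⟨w, x, k⟩
    by_cases h : w = E.r f
    · by_cases hs : E.s f = E.s e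
      · have : Function.partialInv (φ e) (φ f x) = none :=
          partialInv_eq_none fun y hy => hef (hφ e f y x hs.symm hy).1
        simp [edgeMap, ghostMap, h, hs, this]
      · simp [edgeMap, ghostMap, h, hs]
    · simp [edgeMap, h]
  sum_out v hv S hS := by
    refine end_ext_single fun ⟨w, x, k⟩ => ?_
    rw [LinearMap.sum_apply]
    by_cases hw : w = v
    · obtain ⟨e, y, he, rfl⟩ := hV v hv x
      rw [Finset.sum_eq_single e, partialMapEnd_mul,
        partialMapEnd_single_of_some (y' := (w, φ e y, k)),
        partialMapEnd_single_of_some (y' := (w, φ e y, k))]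
      · simp [vertexMap, hw]
      · simp [ghostMap, edgeMap, hw, he, partialInv_branching hφ]
      · intro f hf hfe
        have hs : E.s f = E.s e := ((hS f).1 hf).trans he.symm
        have : Function.partialInv (φ f) (φ e y) = none :=
          partialInv_eq_none fun y' hy => hfe (hφ f e y' y hs hy).1
        rw [partialMapEnd_mul, partialMapEnd_single_of_none]
        simp [ghostMap, this]
      · intro hc
        exact absurd ((hS e).2 he) hc
    · rw [partialMapEnd_single_of_none (by simp [vertexMap, hw])]
      refine Finset.sum_eq_zero fun f hf => ?_
      rw [partialMapEnd_mul, partialMapEnd_single_of_none]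
      have : w ≠ E.s f := fun hc => hw (hc.trans ((hS f).1 hf))
      simp [ghostMap, this]

/-- The integer coordinate counts edges, so paths of different lengths send a basis vector to
different basis vectors, whatever happens in `B`. -/
theorem exists_path_apply_single {u z : E₀} {γ : List E₁} (hγ : E.IsPath u γ z) (x : B) :
    ∃ x', (γ.map fun e => partialMapEnd K (E.edgeMap φ e)).prod (Finsupp.single (z, x, 0) 1) =
      Finsupp.single (u, x', (γ.length : ℤ)) 1 := by
  induction hγ with
  | nil v => exact ⟨x, by simp⟩
  | cons e _ ih =>
    obtain ⟨x', hx'⟩ := ih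
    refine ⟨φ e x', ?_⟩
    rw [List.map_cons, List.prod_cons, Module.End.mul_apply, hx']
    exact partialMapEnd_single_of_some (by simp [edgeMap])

end

end DirGraph

end Representation

/-! ### The relative Leavitt path algebra, its universal property and its amenability. -/

namespace DirGraph

section RelLeavitt

variable (K : Type*) [Field K] {E₀ E₁ : Type*} [Fintype E₀] (E : DirGraph E₀ E₁) (V : Set E₀)

/-- The image of a generator in the relative Leavitt path algebra. -/
noncomputable def leavittGen (g : Gen E₀ E₁) : E.RelLeavitt K V :=
  RingQuot.mkAlgHom K (E.LeavittRel K V) (FreeAlgebra.ι K g)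

theorem isLeavittFamily_leavittGen :
    E.IsLeavittFamily V (fun v => leavittGen K E V (.vertex v))
      (fun e => leavittGen K E V (.edge e)) (fun e => leavittGen K E V (.ghost e)) where
  vertex_idem v := by
    simpa [leavittGen, gv] using RingQuot.mkAlgHom_rel K (LeavittRel.vertex_idem (E := E) (K := K) (V := V) v)
  vertex_orth v w h := by
    simpa [leavittGen, gv] using
      RingQuot.mkAlgHom_rel K (LeavittRel.vertex_orth (E := E) (K := K) (V := V) v w h)
  src_edge e := by
    simpa [leavittGen, gv, ge] using
      RingQuot.mkAlgHom_rel K (LeavittRel.src_edge (E := E) (K := K) (V := V) e)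
  edge_rng e := by
    simpa [leavittGen, gv, ge] using
      RingQuot.mkAlgHom_rel K (LeavittRel.edge_rng (E := E) (K := K) (V := V) e)
  sum_vertex := by
    simpa [leavittGen, gv] using RingQuot.mkAlgHom_rel K (LeavittRel.sum_vertex (E := E) (K := K) (V := V))
  rng_ghost e := by
    simpa [leavittGen, gv, gs] using
      RingQuot.mkAlgHom_rel K (LeavittRel.rng_ghost (E := E) (K := K) (V := V) e)
  ghost_src e := by
    simpa [leavittGen, gv, gs] using
      RingQuot.mkAlgHom_rel K (LeavittRel.ghost_src (E := E) (K := K) (V := V) e)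
  ghost_edge e := by
    simpa [leavittGen, gv, ge, gs] using
      RingQuot.mkAlgHom_rel K (LeavittRel.ghost_edge (E := E) (K := K) (V := V) e)
  ghost_edge_ne e f h := by
    simpa [leavittGen, ge, gs] using
      RingQuot.mkAlgHom_rel K (LeavittRel.ghost_edge_ne (E := E) (K := K) (V := V) e f h)
  sum_out v hv S hS := by
    simpa [leavittGen, gv, ge, gs] using
      RingQuot.mkAlgHom_rel K (LeavittRel.sum_out (E := E) (K := K) (V := V) v hv S hS)

theorem adjoin_leavittGen :
    Algebra.adjoin K (Set.range (fun v => leavittGen K E V (.vertex v)) ∪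
      Set.range (fun e => leavittGen K E V (.edge e)) ∪
      Set.range (fun e => leavittGen K E V (.ghost e))) = ⊤ := by
  have h : Set.range (fun v => leavittGen K E V (.vertex v)) ∪
      Set.range (fun e => leavittGen K E V (.edge e)) ∪
      Set.range (fun e => leavittGen K E V (.ghost e)) =
      RingQuot.mkAlgHom K (E.LeavittRel K V) '' Set.range (FreeAlgebra.ι K) := by
    ext x
    constructor
    · rintro ((⟨v, rfl⟩ | ⟨e, rfl⟩) | ⟨e, rfl⟩) <;> exact ⟨_, ⟨_, rfl⟩, rfl⟩
    · rintro ⟨_, ⟨g, rfl⟩, rfl⟩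
      cases g with
      | vertex v => exact .inl (.inl ⟨v, rfl⟩)
      | edge e => exact .inl (.inr ⟨e, rfl⟩)
      | ghost e => exact .inr ⟨e, rfl⟩
  rw [h, ← AlgHom.map_adjoin, FreeAlgebra.adjoin_range_ι, Algebra.map_top,
    AlgHom.range_eq_top]
  exact RingQuot.mkAlgHom_surjective K _

variable {K E V}

/-- The universal property of the relative Leavitt path algebra. -/
theorem IsLeavittFamily.exists_algHom {A : Type*} [Ring A] [Algebra K A] {p : E₀ → A}
    {a b : E₁ → A} (h : E.IsLeavittFamily V p a b) :
    ∃ ρ : E.RelLeavitt K V →ₐ[K] A, (∀ v, ρ (leavittGen K E V (.vertex v)) = p v) ∧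
      (∀ e, ρ (leavittGen K E V (.edge e)) = a e) ∧
      ∀ e, ρ (leavittGen K E V (.ghost e)) = b e := by
  let g : Gen E₀ E₁ → A := fun x => match x with
    | .vertex v => p v
    | .edge e => a e
    | .ghost e => b e
  have hg : ∀ ⦃x y⦄, E.LeavittRel K V x y → FreeAlgebra.lift K g x = FreeAlgebra.lift K g y := by
    intro x y hxy
    cases hxy with
    | vertex_idem v => simpa [gv, g] using h.vertex_idem v
    | vertex_orth v w hvw => simpa [gv, g] using h.vertex_orth v w hvw
    | src_edge e => simpa [gv, ge, g] using h.src_edge e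
    | edge_rng e => simpa [gv, ge, g] using h.edge_rng e
    | sum_vertex => simpa [gv, g] using h.sum_vertex
    | rng_ghost e => simpa [gv, gs, g] using h.rng_ghost e
    | ghost_src e => simpa [gv, gs, g] using h.ghost_src e
    | ghost_edge e => simpa [gv, ge, gs, g] using h.ghost_edge e
    | ghost_edge_ne e f hef => simpa [ge, gs, g] using h.ghost_edge_ne e f hef
    | sum_out v hv S hS => simpa [gv, ge, gs, g] using h.sum_out v hv S hS
  refine ⟨RingQuot.liftAlgHom K ⟨FreeAlgebra.lift K g, hg⟩, ?_, ?_, ?_⟩ <;>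
  · intro x
    rw [leavittGen, RingQuot.liftAlgHom_mkAlgHom_apply, FreeAlgebra.lift_ι_apply]

/-- The two amenability criteria require a nonzero defect and independent paths; both are detected
by the representation `ρ`. -/
theorem amenable_relLeavitt (hV : V ⊆ E.Reg)
    (h : E.cycleClosure V ≠ Set.univ ∨ ∃ ω : List E₁, E.IsExclusiveCycle ω ∧ E.IsMaximalCycle ω) :
    AmenableAlgebra K (E.RelLeavitt K V) := by
  classical
  obtain ⟨φ, hinj, hsurj, hmiss⟩ := E.exists_branching hV
  obtain ⟨ρ, hv, he, hg⟩ := (isLeavittFamily_partialMapEnd (K := K) hinj hsurj).exists_algHom (K := K)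
  have hL := isLeavittFamily_leavittGen K E V
  rcases h with h | ⟨ω, hω, hmax⟩
  · obtain ⟨z, hzV, hz⟩ := exists_not_reached h
    refine hL.amenable_of_not_reached (adjoin_leavittGen K E V) hz fun F hF => ?_
    -- At a point missed by all edges leaving `z`, every ghost edge in the defect acts as zero,
    -- whereas the vertex `z` acts as the identity.
    obtain ⟨x, hx⟩ := hmiss z hzV
    have h₁ := congrArg (fun y => ρ y (Finsupp.single (z, x, 0) 1)) hF
    have h₂ : ∀ e ∈ F.filter (fun e => E.s e = z),
        (partialMapEnd K (E.edgeMap φ e) * partialMapEnd K (E.ghostMap φ e))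
          (Finsupp.single (z, x, 0) 1) = 0 := by
      intro e he
      have hs := (Finset.mem_filter.1 he).2
      rw [Module.End.mul_apply, partialMapEnd_single_of_none (f := E.ghostMap φ e), map_zero]
      simp [ghostMap, hs, partialInv_eq_none fun y => hx e y hs]
    simp only [vertexDefect, map_sub, map_sum, map_mul, hv, he, hg, LinearMap.sub_apply,
      LinearMap.sum_apply, map_zero, LinearMap.zero_apply] at h₁
    rw [Finset.sum_eq_zero h₂, sub_zero,
      partialMapEnd_single_of_some (y' := (z, x, 0)) (by simp [vertexMap])] at h₁
    simp at h₁
  · refine hL.amenable_of_isMaximalCycle (adjoin_leavittGen K E V) hmax hω.noBranch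
      fun z γ hγ => ?_
    choose hlen u hu using hγ
    choose x hx using fun n =>
      exists_path_apply_single (K := K) (φ := φ) (hu n) (Sum.inr 0)
    -- Evaluation at one basis vector turns the paths into basis vectors with distinct integer
    -- coordinates; `Sum.inr 0` is an arbitrary point.
    let ev : E.RelLeavitt K V →ₗ[K] (E₀ × (E₁ ⊕ ℕ) × ℤ →₀ K) :=
      LinearMap.applyₗ (Finsupp.single (z, Sum.inr 0, 0) 1) ∘ₗ ρ.toLinearMap
    refine LinearIndependent.of_comp ev ?_
    have hev : ev ∘ (fun n => ((γ n).map fun e => leavittGen K E V (.edge e)).prod *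
        leavittGen K E V (.vertex z)) =
        (fun y => Finsupp.single y (1 : K)) ∘ fun n => (u n, x n, (n : ℤ)) := by
      funext n
      have h₁ := hx n
      rw [hlen n] at h₁
      have h₂ : ((γ n).map (⇑ρ ∘ fun e => leavittGen K E V (.edge e))) =
          (γ n).map fun e => partialMapEnd K (E.edgeMap φ e) :=
        List.map_congr_left fun e _ => he e
      simp only [ev, Function.comp_apply, LinearMap.comp_apply, AlgHom.toLinearMap_apply,
        LinearMap.applyₗ_apply_apply, map_mul, map_list_prod, List.map_map, h₂, hv,
        Module.End.mul_apply]
      rw [partialMapEnd_single_of_some (y' := (z, Sum.inr 0, 0)) (by simp [vertexMap]), h₁]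
    rw [hev]
    refine (Finsupp.linearIndependent_single_one K _).comp _ fun m n hmn => ?_
    simpa using (Prod.mk.inj (Prod.mk.inj hmn).2).2

end RelLeavitt

end DirGraph

/-! ### Rank conditions and amenability of general algebras. -/

section RankConditions

/-- Amenable algebras satisfy the strong rank condition. -/
theorem AmenableAlgebra.rightStrongRankCondition {K : Type*} [Field K] {A : Type*} [Ring A]
    [Algebra K A] (h : AmenableAlgebra K A) : RightStrongRankCondition A := by
  classical
  rintro n hn ⟨f, hf⟩
  -- A map of free right modules is left multiplication by a matrix `c`. With `U` spanned by its
  -- entries, it restricts to an injection from `W^(n+1)` to `(UW)^n`, which contradicts amenability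
  -- for the ratio `(n + 1) / n`.
  let c : Fin n → Fin (n + 1) → A := fun i j => f (Pi.single j 1) i
  have hfc : ∀ x i, f x i = ∑ j, c i j * x j := by
    intro x i
    have hx : x = ∑ j, MulOpposite.op (x j) • Pi.single j (1 : A) := by
      funext k
      simp [Finset.sum_apply, Pi.single_apply]
    conv_lhs => rw [hx]
    simp [c, Finset.sum_apply]
  let U : Submodule K A := Submodule.span K (Set.range fun ij : Fin n × Fin (n + 1) => c ij.1 ij.2)
  have hU : FiniteDimensional K U := FiniteDimensional.span_of_finite K (Set.finite_range _)
  have hcU : ∀ i j, c i j ∈ U := fun i j => Submodule.subset_span ⟨(i, j), rfl⟩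
  have hn' : (0 : ℝ) < n := by exact_mod_cast hn
  obtain ⟨W, hW, hlt⟩ := h U hU ((n + 1) / n) (by rw [lt_div_iff₀ hn']; linarith)
  have hUW : FiniteDimensional K (U * W : Submodule K A) :=
    (Submodule.fg_iff_finiteDimensional _).1
      (((Submodule.fg_iff_finiteDimensional _).2 hU).mul
        ((Submodule.fg_iff_finiteDimensional _).2 hW))
  let g : (Fin (n + 1) → W) →ₗ[K] (Fin n → (U * W : Submodule K A)) :=
    { toFun := fun x i => ⟨∑ j, c i j * (x j : A),
        Submodule.sum_mem _ fun j _ => Submodule.mul_mem_mul (hcU i j) (x j).2⟩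
      map_add' := fun x y => by
        funext i; apply Subtype.ext
        simp [mul_add, Finset.sum_add_distrib]
      map_smul' := fun t x => by
        funext i; apply Subtype.ext
        simp [Finset.smul_sum] }
  have hg : Function.Injective g := by
    intro x y hxy
    have hfxy : f (fun j => (x j : A)) = f fun j => (y j : A) := by
      funext i
      rw [hfc, hfc]
      exact congrArg Subtype.val (congrFun hxy i)
    funext j
    exact Subtype.ext (congrFun (hf hfxy) j)
  have hle := LinearMap.finrank_le_finrank_of_injective hg
  simp only [Module.finrank_pi_fintype, Finset.sum_const, Finset.card_univ, Fintype.card_fin,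
    smul_eq_mul] at hle
  rw [div_mul_eq_mul_div, lt_div_iff₀ hn'] at hlt
  have hle' : ((n : ℝ) + 1) * Module.finrank K W ≤
      n * Module.finrank K (U * W : Submodule K A) := by exact_mod_cast hle
  linarith

variable {R : Type*} [Ring R]

/-- An epimorphism onto a free right module splits. -/
theorem exists_injective_of_surjective {ι κ : Type*} [Finite κ]
    (f : (ι → R) →ₗ[Rᵐᵒᵖ] (κ → R)) (hf : Function.Surjective f) :
    ∃ g : (κ → R) →ₗ[Rᵐᵒᵖ] (ι → R), Function.Injective g := by
  have e : Rᵐᵒᵖ ≃ₗ[Rᵐᵒᵖ] R :=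
    { MulOpposite.opAddEquiv.symm with
      map_smul' := fun c x => by simp }
  have : Module.Free Rᵐᵒᵖ R := Module.Free.of_equiv e
  obtain ⟨g, hg⟩ := Module.projective_lifting_property f LinearMap.id hf
  exact ⟨g, Function.LeftInverse.injective (g := f) fun x => LinearMap.congr_fun hg x⟩

/-- The infimum is `⊤` if the set is empty; otherwise it is attained at a positive integer, so a
value at most `1` means `n = 1`. -/
theorem one_lt_generatingNumber_iff :
    1 < generatingNumber R ↔
      ¬ ∃ f : (Fin 1 → R) →ₗ[Rᵐᵒᵖ] (Fin 2 → R), Function.Surjective f := by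
  rw [← not_le, not_iff_not]
  constructor
  · intro h
    have hne : {m : ℕ∞ | ∃ n : ℕ, m = n ∧ 0 < n ∧
        ∃ f : (Fin n → R) →ₗ[Rᵐᵒᵖ] (Fin (n + 1) → R), Function.Surjective f}.Nonempty := by
      by_contra hc
      rw [Set.not_nonempty_iff_eq_empty] at hc
      rw [generatingNumber, hc, sInf_empty] at h
      simp at h
    obtain ⟨n, hn, hpos, hf⟩ := csInf_mem hne
    rw [generatingNumber, hn] at h
    have hn1 : n = 1 := by
      have : n ≤ 1 := by exact_mod_cast h
      omega
    subst hn1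
    exact hf
  · intro hf
    exact sInf_le ⟨1, by simp, one_pos, hf⟩

end RankConditions

/-! ### The equivalence of the six statements. -/

theorem theorem4p12 {K : Type*} [Field K] {E₀ : Type*} [Fintype E₀] {E₁ : Type*}
    (E : DirGraph E₀ E₁) (V : Set E₀) (hV : V ⊆ E.Reg) :
    List.TFAE [
      AmenableAlgebra K (E.RelLeavitt K V),
      RightStrongRankCondition (E.RelLeavitt K V),
      ¬ ∃ f : (Fin 2 → E.RelLeavitt K V) →ₗ[(E.RelLeavitt K V)ᵐᵒᵖ] E.RelLeavitt K V,
        Function.Injective f,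
      RightRankCondition (E.RelLeavitt K V),
      1 < generatingNumber (E.RelLeavitt K V),
      E.cycleClosure V ≠ Set.univ ∨ ∃ ω : List E₁, E.IsExclusiveCycle ω ∧ E.IsMaximalCycle ω] := by
  tfae_have 1 → 2 := AmenableAlgebra.rightStrongRankCondition
  tfae_have 2 → 3 := by
    rintro h ⟨f, hf⟩
    let e := LinearEquiv.funUnique (Fin 1) (E.RelLeavitt K V)ᵐᵒᵖ (E.RelLeavitt K V)
    exact h 1 one_pos ⟨e.symm.toLinearMap ∘ₗ f, e.symm.injective.comp hf⟩
  tfae_have 3 → 5 := by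
    rw [one_lt_generatingNumber_iff]
    rintro h ⟨f, hf⟩
    obtain ⟨g, hg⟩ := exists_injective_of_surjective f hf
    let e := LinearEquiv.funUnique (Fin 1) (E.RelLeavitt K V)ᵐᵒᵖ (E.RelLeavitt K V)
    exact h ⟨e.toLinearMap ∘ₗ g, e.injective.comp hg⟩
  tfae_have 2 → 4 := by
    rintro h n hn ⟨f, hf⟩
    exact h n hn (exists_injective_of_surjective f hf)
  tfae_have 4 → 5 := by
    rw [one_lt_generatingNumber_iff]
    exact fun h => h 1 one_pos
  tfae_have 5 → 6 := by
    rw [one_lt_generatingNumber_iff]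
    contrapose!
    rintro ⟨hX, hω⟩
    obtain ⟨f, hf⟩ := (DirGraph.isLeavittFamily_leavittGen K E V).mapsOnto_prod_self hV hX
      (by push Not; exact hω)
    let e := LinearEquiv.funUnique (Fin 1) (E.RelLeavitt K V)ᵐᵒᵖ (E.RelLeavitt K V)
    let e' := (LinearEquiv.finTwoArrow (E.RelLeavitt K V)ᵐᵒᵖ (E.RelLeavitt K V)).symm
    exact ⟨e'.toLinearMap ∘ₗ f ∘ₗ e.toLinearMap, e'.surjective.comp (hf.comp e.surjective)⟩
  tfae_have 6 → 1 := DirGraph.amenable_relLeavitt hV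
  tfae_finish
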